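/- Let $0<\alpha\le 1$, $\beta>1$, $\gamma>0$ and $\lambda\in\mathbb R$. Let $\gamma_0$ be the Euler--Mascheroni constant and let $$E^{g}_{a,b}(z)=\sum_{k=0}^{\infty}\frac{(g)_k\,z^k}{k!\,\Gamma(a k+b)},\qquad (g)_k=g(g+1)\cdots(g+k-1),$$ be the Prabhakar function ($a,b>0$, $g\in\mathbb R$). For $0<\alpha<1$ and $t_1,t_2>0$ put $$\Phi_{\alpha,0}(t_1,t_2)=\frac1\pi\int_0^{\infty}\exp\bigl(-u t_1-t_2u^{\alpha}\cos(\pi\alpha)\bigr)\,\sin\bigl(t_2u^{\alpha}\sin(\pi\alpha)\bigr)\,du ,$$ and for $\alpha=1$ let $\Phi_{1,0}(t_1,t_2)=\delta(t_1-t_2)$ be the delta function, so that $\int_0^\infty\Phi_{1,0}(t_1,t_2)f(t_2)\,dt_2=f(t_1)$. Then for every $t\ge 0$ the function $g\mapsto t^{\beta-1}E^{g}_{\alpha,\beta}(\lambda t^{\alpha})$ is differentiable at $g=\gamma$, and $$\begin{aligned}\frac{\partial}{\partial\gamma}\Bigl(t^{\beta-1}E^{\gamma}_{\alpha,\beta}(\lambda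 t^{\alpha})\Bigr)={}&-\alpha\int_0^t\bigl(\ln(t-t_1)+\gamma_0\bigr)\,t_1^{\beta-2}E^{\gamma}_{\alpha,\beta-1}(\lambda t_1^{\alpha})\,dt_1\\&+\int_0^t(t-t_1)^{\beta-\alpha-1}E^{\gamma-1}_{\alpha,\beta-\alpha}\bigl(\lambda(t-t_1)^{\alpha}\bigr)\left(\int_0^{\infty}\Phi_{\alpha,0}(t_1,t_2)\,e^{\lambda t_2}(\ln t_2+\gamma_0)\,dt_2\right)dt_1 .\end{aligned}$$ All the integrals involved converge absolutely (for $\alpha<1$ the integral defining $\Phi_{\alpha,0}(t_1,t_2)$ for all $t_1,t_2>0$, and the inner integral over $t_2$ for all $t_1>0$). -/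

import Mathlib

/-- The Prabhakar (three-parametric Mittag-Leffler) function
`E^γ_{α,β}(z) = ∑ₖ (γ)ₖ zᵏ / (k! Γ(α k + β))`, where `(γ)ₖ = γ (γ + 1) ⋯ (γ + k - 1)`. -/
noncomputable def prabhakar (α β γ z : ℝ) : ℝ :=
  ∑' k : ℕ, (ascPochhammer ℝ k).eval γ * z ^ k / ((k.factorial : ℝ) * Real.Gamma (α * k + β))

/-- The integrand, in the variable `u`, of the integral that defines the kernel `Φ_{a,b}(t, t')`. -/
noncomputable def efrosKernelIntegrand (a b t t' u : ℝ) : ℝ :=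
  Real.sin (t' * u ^ a * Real.sin (Real.pi * a) + Real.pi * b) /
    (u ^ b * Real.exp (u * t + t' * u ^ a * Real.cos (Real.pi * a)))

/-- The kernel `Φ_{a,b}(t, t')` for `0 < a < 1`: the inverse Laplace transform in `t` of
`s ↦ s^{-b} exp (-t' s^a)`, written as a real integral over the branch cut. -/
noncomputable def efrosKernel (a b t t' : ℝ) : ℝ :=
  Real.pi⁻¹ * (∫ u in Set.Ioi (0 : ℝ), efrosKernelIntegrand a b t t' u) +
    (if b = 1 then 1 else 0)

/-- The integral `∫₀^∞ Φ_{a,0}(t, t') f(t') dt'` for `0 < a ≤ 1`. For `a = 1` the kernel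
`Φ_{1,0}(t, t')` is the delta function `δ(t - t')`, so that the integral is `f(t)`. -/
noncomputable def efrosTransform (a : ℝ) (f : ℝ → ℝ) (t : ℝ) : ℝ :=
  if a = 1 then f t else ∫ t' in Set.Ioi (0 : ℝ), efrosKernel a 0 t t' * f t'

section

open MeasureTheory Set Filter Topology
open Finset.HasAntidiagonal (antidiagonal mem_antidiagonal)

/-!
Everything is expanded in the Riemann–Liouville kernels `t^(a-1) / Γ(a)`, whose orders add under
convolution; differentiating a kernel in its order `a` multiplies it by `log t - ψ(a)`, which is how
logarithms arise. In particular `log t + γ₀` is the derivative of the kernel at order `1`.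

For `α < 1`, rotating the Bromwich contour between the branch cut and rays into the left half-plane
bounds `Φ_{α,0}(t, ·)` and computes its moments of small order; by analytic continuation its Mellin
transform is `s ↦ Γ(s) t^(α s - 1) / Γ(α s)`. So integration against `Φ_{α,0}(t, ·)` turns the
kernel of order `a` into that of order `α a`, and the derivative kernel of order `a` into `α` times
that of order `α a`. As `ψ(n + 1) = Hₙ - γ₀` for the harmonic numbers `Hₙ`, it maps
`xⁿ / n! * (log x + γ₀)` to `Hₙ` times the kernel of order `α (n + 1)` plus `α` times its derivative
in the order; for `α = 1` this is immediate.

Comparing the coefficients of `λ^N`, the derivative kernels of the two integrals cancel because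
`∑_{j ≤ N} (γ - 1)_j / j! = (γ)_N / N!` (Chu–Vandermonde), and what remains is
`∑_{j ≤ N} (γ - 1)_j / j! * H_{N - j} = d/dγ (γ)_N / N!`, the derivative of the same identity.
-/

section Gamma

/-- The logarithmic derivative of the real Gamma function. -/
noncomputable def realDigamma (x : ℝ) : ℝ := logDeriv Real.Gamma x

/-- The Riemann–Liouville kernel of order `a`: convolution with it is fractional integration of
order `a`. -/
noncomputable def rlKernel (a t : ℝ) : ℝ := t ^ (a - 1) / Real.Gamma a

/-- The derivative of the Riemann–Liouville kernel with respect to its order. -/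
noncomputable def rlKernelDeriv (a t : ℝ) : ℝ := rlKernel a t * (Real.log t - realDigamma a)

theorem differentiableAt_Gamma_of_pos {x : ℝ} (hx : 0 < x) : DifferentiableAt ℝ Real.Gamma x :=
  Real.differentiableAt_Gamma fun m => ((neg_nonpos.2 m.cast_nonneg).trans_lt hx).ne'

theorem hasDerivAt_log_Gamma {x : ℝ} (hx : 0 < x) :
    HasDerivAt (Real.log ∘ Real.Gamma) (realDigamma x) x :=
  (differentiableAt_Gamma_of_pos hx).hasDerivAt.log (Real.Gamma_pos_of_pos hx).ne'

theorem monotoneOn_realDigamma : MonotoneOn realDigamma (Ioi 0) :=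
  (Real.convexOn_log_Gamma.monotoneOn_deriv fun _ hz =>
    (hasDerivAt_log_Gamma hz).differentiableAt).congr fun _ hz => (hasDerivAt_log_Gamma hz).deriv

theorem log_Gamma_add_one {x : ℝ} (hx : 0 < x) :
    Real.log (Real.Gamma (x + 1)) = Real.log x + Real.log (Real.Gamma x) := by
  rw [Real.Gamma_add_one hx.ne', Real.log_mul hx.ne' (Real.Gamma_pos_of_pos hx).ne']

theorem realDigamma_le_log {x : ℝ} (hx : 0 < x) : realDigamma x ≤ Real.log x := by
  have h := Real.convexOn_log_Gamma.le_slope_of_hasDerivAt hx (hx.trans (lt_add_one x))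
    (lt_add_one x) (hasDerivAt_log_Gamma hx)
  simpa [slope_def_field, log_Gamma_add_one hx] using h

theorem abs_realDigamma_le {a x : ℝ} (ha : 0 < a) (hx : a ≤ x) :
    |realDigamma x| ≤ |realDigamma a| + x := by
  have hx0 : 0 < x := ha.trans_le hx
  have lower : realDigamma a ≤ realDigamma x := monotoneOn_realDigamma ha hx0 hx
  have upper : realDigamma x ≤ x := (realDigamma_le_log hx0).trans (Real.log_le_self hx0.le)
  rw [abs_le]
  constructor <;> linarith [neg_abs_le (realDigamma a), abs_nonneg (realDigamma a)]

theorem realDigamma_nat_add_one (n : ℕ) :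
    realDigamma (n + 1) = harmonic n - Real.eulerMascheroniConstant := by
  have : (n.factorial : ℝ) ≠ 0 := by positivity
  rw [realDigamma, logDeriv_apply, Real.deriv_Gamma_nat, Real.Gamma_nat_eq_factorial]
  field_simp
  ring

theorem rlKernel_nat_add_one (n : ℕ) (t : ℝ) : rlKernel (n + 1) t = t ^ n / n.factorial := by
  rw [rlKernel, add_sub_cancel_right, Real.rpow_natCast, Real.Gamma_nat_eq_factorial]

theorem rlKernelDeriv_one (t : ℝ) :
    rlKernelDeriv 1 t = Real.log t + Real.eulerMascheroniConstant := by
  have hdigamma : realDigamma 1 = -Real.eulerMascheroniConstant := by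
    simpa using realDigamma_nat_add_one 0
  have hkernel : rlKernel 1 t = 1 := by simpa using rlKernel_nat_add_one 0 t
  rw [rlKernelDeriv, hdigamma, hkernel, one_mul, sub_neg_eq_add]

theorem hasDerivAt_rlKernel {a t : ℝ} (ha : 0 < a) (ht : 0 < t) :
    HasDerivAt (fun b => rlKernel b t) (rlKernelDeriv a t) a := by
  have hpow : HasDerivAt (fun b : ℝ => t ^ (b - 1)) (Real.log t * 1 * t ^ (a - 1)) a :=
    ((hasDerivAt_id a).sub_const 1).const_rpow ht
  have hG := (Real.Gamma_pos_of_pos ha).ne'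
  refine (hpow.div (differentiableAt_Gamma_of_pos ha).hasDerivAt hG).congr_deriv ?_
  simp only [rlKernelDeriv, rlKernel, realDigamma, logDeriv_apply]
  field_simp

@[fun_prop]
theorem measurable_rlKernel (a : ℝ) : Measurable (rlKernel a) := by
  unfold rlKernel; fun_prop

@[fun_prop]
theorem measurable_rlKernelDeriv (a : ℝ) : Measurable (rlKernelDeriv a) := by
  unfold rlKernelDeriv; fun_prop

/-- Convexity of `log Γ` compares the slopes over `[x - 1, x]` and `[x, x + a]`. -/
theorem Gamma_mul_rpow_le_Gamma_add {a x : ℝ} (ha : 0 < a) (hx : 1 < x) :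
    Real.Gamma x * (x - 1) ^ a ≤ Real.Gamma (x + a) := by
  have hx1 : 0 < x - 1 := sub_pos.2 hx
  have hxa : 0 < x + a := by linarith
  have hslope := Real.convexOn_log_Gamma.slope_mono_adjacent (x := x - 1) (y := x) (z := x + a)
    hx1 hxa (by linarith) (by linarith)
  have hrec := log_Gamma_add_one hx1
  rw [sub_add_cancel] at hrec
  simp only [Function.comp, hrec, sub_sub_cancel, div_one, add_sub_cancel_left,
    add_sub_cancel_right] at hslope
  rw [le_div_iff₀ ha] at hslope
  have hGx := Real.Gamma_pos_of_pos (zero_lt_one.trans hx)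
  rw [← Real.log_le_log_iff (by positivity) (Real.Gamma_pos_of_pos hxa),
    Real.log_mul hGx.ne' (by positivity), Real.log_rpow hx1]
  linarith

theorem summable_pow_div_Gamma {a b x : ℝ} (ha : 0 < a) (hb : 0 < b) (hx : 0 ≤ x) :
    Summable fun k : ℕ => x ^ k / Real.Gamma (a * k + b) := by
  have hpos (k : ℕ) : 0 < Real.Gamma (a * k + b) := Real.Gamma_pos_of_pos (by positivity)
  have hlin : Tendsto (fun k : ℕ => a * (k : ℝ) + b) atTop atTop :=
    tendsto_atTop_add_const_right _ _ (tendsto_natCast_atTop_atTop.const_mul_atTop ha)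
  have hlim : Tendsto (fun k : ℕ => (a * k + b - 1) ^ a) atTop atTop :=
    (tendsto_rpow_atTop ha).comp (tendsto_atTop_add_const_right _ (-1) hlin)
  refine summable_of_ratio_norm_eventually_le (r := 1 / 2) (by norm_num) ?_
  filter_upwards [hlim.eventually_ge_atTop (2 * x), hlin.eventually_gt_atTop 1] with k hk hk1
  have hratio : Real.Gamma (a * k + b) * (2 * x) ≤ Real.Gamma (a * (k + 1 : ℕ) + b) := by
    calc Real.Gamma (a * k + b) * (2 * x)
        ≤ Real.Gamma (a * k + b) * (a * k + b - 1) ^ a := by have := hpos k; gcongr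
      _ ≤ Real.Gamma (a * k + b + a) := Gamma_mul_rpow_le_Gamma_add ha hk1
      _ = Real.Gamma (a * (k + 1 : ℕ) + b) := by push_cast; ring_nf
  have := hpos k
  have := hpos (k + 1)
  rw [Real.norm_of_nonneg (by positivity), Real.norm_of_nonneg (by positivity), pow_succ,
    div_le_iff₀ (hpos (k + 1))]
  calc x ^ k * x = 1 / 2 * (x ^ k / Real.Gamma (a * k + b)) *
          (Real.Gamma (a * k + b) * (2 * x)) := by field_simp
    _ ≤ _ := by gcongr

end Gamma

section Mellin

theorem mellin_ofReal (f : ℝ → ℝ) (s : ℝ) :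
    mellin (fun x => (f x : ℂ)) s = ((∫ x in Ioi 0, x ^ (s - 1) * f x : ℝ) : ℂ) := by
  rw [mellin, ← integral_complex_ofReal]
  refine setIntegral_congr_fun measurableSet_Ioi fun x (hx : 0 < x) => ?_
  push_cast [Complex.ofReal_cpow hx.le]
  rfl

theorem integrableOn_rpow_mul_of_mellinConvergent {f : ℝ → ℝ} {s : ℝ}
    (hf : MellinConvergent (fun x => (f x : ℂ)) s) :
    IntegrableOn (fun x => x ^ (s - 1) * f x) (Ioi 0) := by
  refine IntegrableOn.congr_fun (RCLike.reCLM (K := ℂ) |>.integrable_comp hf)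
    (fun x (hx : 0 < x) => ?_) measurableSet_Ioi
  simp [← Complex.ofReal_one, ← Complex.ofReal_sub, ← Complex.ofReal_cpow hx.le,
    ← Complex.ofReal_mul]

theorem hasDerivAt_integral_rpow_mul {f : ℝ → ℝ} {p q r : ℝ}
    (hf : LocallyIntegrableOn f (Ioi 0))
    (hf_top : f =O[atTop] (· ^ (-q))) (hq : p < q) (hf_bot : f =O[𝓝[>] 0] (· ^ (-r))) (hr : r < p) :
    IntegrableOn (fun x => x ^ (p - 1) * f x) (Ioi 0) ∧
      IntegrableOn (fun x => x ^ (p - 1) * (Real.log x * f x)) (Ioi 0) ∧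
      HasDerivAt (fun s => ∫ x in Ioi 0, x ^ (s - 1) * f x)
        (∫ x in Ioi 0, x ^ (p - 1) * (Real.log x * f x)) p := by
  set F : ℝ → ℂ := fun x => (f x : ℂ)
  have hF : LocallyIntegrableOn F (Ioi 0) := fun x hx =>
    (hf x hx).imp fun _ h => ⟨h.1, h.2.ofReal⟩
  have hF_top : F =O[atTop] (· ^ (-q)) := Complex.isBigO_ofReal_left.2 hf_top
  have hF_bot : F =O[𝓝[>] 0] (· ^ (-r)) := Complex.isBigO_ofReal_left.2 hf_bot
  have hconv := mellinConvergent_of_isBigO_rpow (s := (p : ℂ)) hF hF_top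
    (by simpa using hq) hF_bot (by simpa using hr)
  obtain ⟨hlog, hderiv⟩ := mellin_hasDerivAt_of_isBigO_rpow (s := (p : ℂ)) hF hF_top
    (by simpa using hq) hF_bot (by simpa using hr)
  have hlogF : (fun x => Real.log x • F x) = fun x => ((Real.log x * f x : ℝ) : ℂ) := by
    ext x; simp [F]
  rw [hlogF] at hlog hderiv
  refine ⟨integrableOn_rpow_mul_of_mellinConvergent hconv,
    integrableOn_rpow_mul_of_mellinConvergent hlog, ?_⟩
  rw [mellin_ofReal] at hderiv
  simpa only [F, mellin_ofReal, Complex.ofReal_re] using hderiv.real_of_complex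

theorem integral_rlKernelDeriv_mul {f N : ℝ → ℝ} {p q r N' : ℝ} (hp : 0 < p)
    (hf : LocallyIntegrableOn f (Ioi 0))
    (hf_top : f =O[atTop] (· ^ (-q))) (hq : p < q) (hf_bot : f =O[𝓝[>] 0] (· ^ (-r))) (hr : r < p)
    (hN : ∀ᶠ s in 𝓝 p, ∫ x in Ioi 0, rlKernel s x * f x = N s) (hN' : HasDerivAt N N' p) :
    IntegrableOn (fun x => rlKernel p x * f x) (Ioi 0) ∧
      IntegrableOn (fun x => rlKernelDeriv p x * f x) (Ioi 0) ∧
      ∫ x in Ioi 0, rlKernelDeriv p x * f x = N' := by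
  obtain ⟨hint, hint_log, hderiv⟩ := hasDerivAt_integral_rpow_mul hf hf_top hq hf_bot hr
  have hG := (Real.Gamma_pos_of_pos hp).ne'
  have hkernel (s x : ℝ) : rlKernel s x * f x = x ^ (s - 1) * f x / Real.Gamma s := by
    rw [rlKernel]; ring
  have hkernelDeriv (x : ℝ) : rlKernelDeriv p x * f x =
      x ^ (p - 1) * (Real.log x * f x) / Real.Gamma p -
        x ^ (p - 1) * f x * (realDigamma p / Real.Gamma p) := by
    simp only [rlKernelDeriv, rlKernel]
    ring
  simp only [hkernel, hkernelDeriv, integral_div] at hN ⊢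
  refine ⟨hint.div_const _, (hint_log.div_const _).sub (hint.mul_const _), ?_⟩
  rw [integral_sub (hint_log.div_const _) (hint.mul_const _), integral_div, integral_mul_const]
  refine HasDerivAt.unique ?_ (hN'.congr_of_eventuallyEq hN)
  refine (hderiv.div (differentiableAt_Gamma_of_pos hp).hasDerivAt hG).congr_deriv ?_
  rw [realDigamma, logDeriv_apply]
  field_simp

end Mellin

section Convolution

variable {a b t : ℝ}

theorem integral_rlKernel_mul_rlKernel (ha : 0 < a) (hb : 0 < b) (ht : 0 < t) :
    ∫ s in Ioo 0 t, rlKernel a (t - s) * rlKernel b s = rlKernel (a + b) t := by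
  have hbeta := Complex.betaIntegral_scaled b a ht
  rw [Complex.betaIntegral_eq_Gamma_mul_div _ _ (by simpa) (by simpa),
    intervalIntegral.integral_of_le ht.le, integral_Ioc_eq_integral_Ioo] at hbeta
  have hreal : ∫ s in Ioo 0 t, s ^ (b - 1) * (t - s) ^ (a - 1) =
      Real.Gamma b * Real.Gamma a * rlKernel (a + b) t := by
    rw [← Complex.ofReal_inj, ← integral_complex_ofReal]
    refine Eq.trans (setIntegral_congr_fun measurableSet_Ioo fun s hs => ?_) (hbeta.trans ?_)
    · push_cast [Complex.ofReal_cpow hs.1.le, Complex.ofReal_cpow (sub_nonneg.2 hs.2.le)]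
      rfl
    · simp only [rlKernel]
      push_cast [Complex.ofReal_cpow ht.le, ← Complex.Gamma_ofReal]
      rw [add_comm (a : ℂ) b]
      ring
  have hGa := (Real.Gamma_pos_of_pos ha).ne'
  have hGb := (Real.Gamma_pos_of_pos hb).ne'
  calc ∫ s in Ioo 0 t, rlKernel a (t - s) * rlKernel b s
      = ∫ s in Ioo 0 t, (Real.Gamma b * Real.Gamma a)⁻¹ * (s ^ (b - 1) * (t - s) ^ (a - 1)) := by
        congr 1 with s
        simp only [rlKernel]
        field_simp
    _ = rlKernel (a + b) t := by
        rw [integral_const_mul, hreal]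
        field_simp

theorem integrableOn_rlKernel_sub (ha : 0 < a) (ht : 0 < t) :
    IntegrableOn (fun s => rlKernel a (t - s)) (Ioo 0 t) := by
  have h := (intervalIntegral.intervalIntegrable_rpow' (a := 0) (b := t) (r := a - 1)
    (by linarith)).comp_sub_left t
  rw [sub_zero, sub_self] at h
  exact ((intervalIntegrable_iff_integrableOn_Ioo_of_le ht.le).1 h.symm).div_const _

theorem rlKernel_convolution (ha : 0 < a) (hb : 0 < b) (ht : 0 < t) :
    IntegrableOn (fun s => rlKernel a (t - s) * rlKernel b s) (Ioo 0 t) ∧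
    IntegrableOn (fun s => rlKernel a (t - s) * rlKernelDeriv b s) (Ioo 0 t) ∧
      ∫ s in Ioo 0 t, rlKernel a (t - s) * rlKernelDeriv b s = rlKernelDeriv (a + b) t := by
  set f : ℝ → ℝ := (Ioo 0 t).indicator fun s => rlKernel a (t - s)
  have hf : LocallyIntegrableOn f (Ioi 0) :=
    ((integrableOn_rlKernel_sub ha ht).integrable_indicator
      measurableSet_Ioo).locallyIntegrable.locallyIntegrableOn _
  have hf_top : f =O[atTop] (· ^ (-(b + 1))) := by
    refine Asymptotics.IsBigO.of_bound 0 ?_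
    filter_upwards [eventually_ge_atTop t] with x hx
    simp [f, hx.not_gt]
  have hf_bot : f =O[𝓝[>] 0] (· ^ (-(0 : ℝ))) := by
    have hcont : ContinuousAt (fun s => rlKernel a (t - s)) 0 :=
      ((continuousAt_const.sub continuousAt_id).rpow_const
        (.inl (by simpa using ht.ne'))).div_const _
    have h1 := (hcont.tendsto.mono_left (nhdsWithin_le_nhds (s := Ioi 0))).isBigO_one ℝ
    have hf_eq : (fun s => rlKernel a (t - s)) =ᶠ[𝓝[>] 0] f := by
      filter_upwards [Ioo_mem_nhdsGT ht] with x hx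
      simp [f, hx.1, hx.2]
    simpa only [neg_zero, Real.rpow_zero] using h1.congr' hf_eq .rfl
  have hmul (g : ℝ → ℝ) : (fun s => g s * f s) =
      (Ioo 0 t).indicator fun s => rlKernel a (t - s) * g s := by
    ext s
    by_cases hs : s ∈ Ioo 0 t <;> simp [f, hs, mul_comm]
  have hon (g : ℝ → ℝ) : IntegrableOn (fun s => g s * f s) (Ioi 0) ↔
      IntegrableOn (fun s => rlKernel a (t - s) * g s) (Ioo 0 t) := by
    rw [hmul, IntegrableOn, integrable_indicator_iff measurableSet_Ioo, IntegrableOn,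
      Measure.restrict_restrict measurableSet_Ioo, inter_eq_left.2 Ioo_subset_Ioi_self]
    rfl
  have hint (g : ℝ → ℝ) : ∫ s in Ioi 0, g s * f s = ∫ s in Ioo 0 t, rlKernel a (t - s) * g s := by
    simp only [hmul, setIntegral_indicator measurableSet_Ioo, inter_eq_right.2 Ioo_subset_Ioi_self]
  rw [← hon, ← hon, ← hint]
  refine integral_rlKernelDeriv_mul hb hf hf_top (lt_add_one b) hf_bot hb
    ((lt_mem_nhds hb).mono fun s hs => ?_)
    ((hasDerivAt_rlKernel (add_pos ha hb) ht).comp_const_add a b)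
  exact (hint _).trans (integral_rlKernel_mul_rlKernel ha hs ht)

end Convolution

section Holomorphic

theorem differentiableOn_integral_of_locally_dominated {X E : Type*} [MeasurableSpace X]
    [NormedAddCommGroup E] [NormedSpace ℂ E] {μ : Measure X} {U : Set ℂ} (hU : IsOpen U)
    {F : ℂ → X → E} (hF_meas : ∀ z ∈ U, AEStronglyMeasurable (F z) μ)
    (hF_diff : ∀ᵐ x ∂μ, DifferentiableOn ℂ (fun z => F z x) U)
    (hF_bound : ∀ z ∈ U, ∃ g : X → ℝ, Integrable g μ ∧
      ∃ V ∈ 𝓝 z, ∀ᵐ x ∂μ, ∀ w ∈ V, ‖F w x‖ ≤ g x) :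
    DifferentiableOn ℂ (fun z => ∫ x, F z x ∂μ) U := by
  intro z hz
  obtain ⟨g, hg, V, hV, hFg⟩ := hF_bound z hz
  obtain ⟨ε, hε, hball⟩ := Metric.mem_nhds_iff.1 (inter_mem hV (hU.mem_nhds hz))
  have hε2 : 0 < ε / 2 := half_pos hε
  have hsub {w : ℂ} (hw : w ∈ Metric.ball z (ε / 2)) : Metric.closedBall w (ε / 2) ⊆ V ∩ U := by
    refine Subset.trans (fun y hy => ?_) hball
    rw [Metric.mem_ball] at hw ⊢
    linarith [dist_triangle y w z, Metric.mem_closedBall.1 hy]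
  have hderiv_meas : AEStronglyMeasurable (fun x => deriv (fun w => F w x) z) μ := by
    obtain ⟨w, hw, hwU⟩ := exists_seq_forall_of_frequently
      (eventually_nhdsWithin_of_eventually_nhds (s := {z}ᶜ) (hU.eventually_mem hz)).frequently
    refine aestronglyMeasurable_of_tendsto_ae atTop (f := fun n x => slope (fun w => F w x) z (w n))
      (fun n => ((hF_meas _ (hwU n)).sub (hF_meas z hz)).const_smul _) ?_
    filter_upwards [hF_diff] with x hx
    exact (hx.differentiableAt (hU.mem_nhds hz)).hasDerivAt.tendsto_slope.comp hw
  refine (hasDerivAt_integral_of_dominated_loc_of_deriv_le (bound := fun x => g x / (ε / 2))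
    (F' := fun w x => deriv (fun w => F w x) w) (Metric.ball_mem_nhds z hε2) ?_ ?_ hderiv_meas ?_
    (hg.div_const _) ?_).2.differentiableAt.differentiableWithinAt
  · filter_upwards [hU.mem_nhds hz] with w hw using hF_meas w hw
  · exact hg.mono' (hF_meas z hz) (hFg.mono fun x hx => hx z (mem_of_mem_nhds hV))
  · filter_upwards [hF_diff, hFg] with x hdiff hbound w hw
    refine Complex.norm_deriv_le_of_forall_mem_sphere_norm_le hε2 ?_ fun y hy =>
      hbound y (hsub hw (Metric.sphere_subset_closedBall hy)).1
    exact (hdiff.mono fun y hy => (hsub hw hy).2).diffContOnCl_ball subset_rfl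
  · filter_upwards [hF_diff] with x hdiff w hw
    exact (hdiff.differentiableAt (hU.mem_nhds
      (hsub hw (Metric.mem_closedBall_self hε2.le)).2)).hasDerivAt

theorem isOpen_re_pos : IsOpen {s : ℂ | 0 < s.re} :=
  isOpen_lt continuous_const Complex.continuous_re

theorem eqOn_re_pos_of_eq_ofReal {F G : ℂ → ℂ} {a b : ℝ} (ha : 0 ≤ a) (hab : a < b)
    (hF : DifferentiableOn ℂ F {s | 0 < s.re}) (hG : DifferentiableOn ℂ G {s | 0 < s.re})
    (h : ∀ x ∈ Ioo a b, F (x : ℝ) = G x) : EqOn F G {s | 0 < s.re} := by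
  obtain ⟨m, hm⟩ := nonempty_Ioo.2 hab
  have hm0 : 0 < m := ha.trans_lt hm.1
  refine (hF.analyticOnNhd isOpen_re_pos).eqOn_of_preconnected_of_frequently_eq
    (hG.analyticOnNhd isOpen_re_pos) (convex_halfSpace_re_gt 0).isPreconnected (z₀ := (m : ℂ))
    (by simpa) ?_
  have hlim : Tendsto (fun x : ℝ => (x : ℂ)) (𝓝[≠] m) (𝓝[≠] m) :=
    Complex.continuous_ofReal.continuousWithinAt.tendsto_nhdsWithin fun x hx => by simpa using hx
  exact hlim.frequently (eventually_nhdsWithin_of_eventually_nhds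
    ((isOpen_Ioo.eventually_mem hm).mono h)).frequently

theorem integrableOn_rpow_mul_exp_neg {p k : ℝ} (hp : -1 < p) (hk : 0 < k) :
    IntegrableOn (fun x : ℝ => x ^ p * Real.exp (-k * x)) (Ioi 0) := by
  simpa using integrableOn_rpow_mul_exp_neg_mul_rpow hp one_pos hk

theorem norm_rpow_mul_cexp_neg {v : ℝ} (hv : 0 ≤ v) (p : ℝ) (r : ℂ) :
    ‖((v ^ p : ℝ) : ℂ) * Complex.exp (-(r * v))‖ = v ^ p * Real.exp (-r.re * v) := by
  rw [norm_mul, Complex.norm_of_nonneg (Real.rpow_nonneg hv p), Complex.norm_exp]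
  simp

/-- Mathlib's Gamma integral has a real rate; the identity theorem extends it to complex ones. -/
theorem integral_rpow_mul_cexp_neg {a : ℝ} (ha : 0 < a) {r : ℂ} (hr : 0 < r.re) :
    ∫ v in Ioi (0 : ℝ), ((v ^ (a - 1) : ℝ) : ℂ) * Complex.exp (-(r * v)) =
      Real.Gamma a * r ^ (-(a : ℂ)) := by
  have hp : -1 < a - 1 := by linarith
  have hleft : DifferentiableOn ℂ (fun r : ℂ => ∫ v in Ioi (0 : ℝ),
      ((v ^ (a - 1) : ℝ) : ℂ) * Complex.exp (-(r * v))) {r | 0 < r.re} := by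
    refine differentiableOn_integral_of_locally_dominated isOpen_re_pos
      (fun r _ => by fun_prop) (.of_forall fun v => by fun_prop) fun r hr => ?_
    refine ⟨_, integrableOn_rpow_mul_exp_neg hp (half_pos hr), {w | r.re / 2 < w.re},
      (isOpen_lt continuous_const Complex.continuous_re).mem_nhds (half_lt_self (a := r.re) hr),
      ?_⟩
    filter_upwards [self_mem_ae_restrict measurableSet_Ioi] with v (hv : 0 < v) w hw
    rw [norm_rpow_mul_cexp_neg hv.le]
    gcongr
  have hright : DifferentiableOn ℂ (fun r : ℂ => Real.Gamma a * r ^ (-(a : ℂ))) {r | 0 < r.re} :=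
    fun r hr => ((differentiableAt_id.cpow_const (.inl hr)).const_mul _).differentiableWithinAt
  refine eqOn_re_pos_of_eq_ofReal le_rfl one_pos hleft hright (fun x hx => ?_) hr
  have hreal := congrArg Complex.ofReal (Real.integral_rpow_mul_exp_neg_mul_Ioi ha hx.1)
  rw [← integral_complex_ofReal, one_div, Real.inv_rpow hx.1.le, ← Real.rpow_neg hx.1.le,
    mul_comm] at hreal
  push_cast [Complex.ofReal_cpow hx.1.le] at hreal ⊢
  exact hreal

end Holomorphic

section RayIntegral

/-- The integral of `f` along the ray that starts at `c` in the direction `ζ`. -/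
noncomputable def rayIntegral (f : ℂ → ℂ) (c ζ : ℂ) : ℂ := ∫ v in Ioi (0 : ℝ), ζ * f (c + v * ζ)

theorem rayIntegral_ofReal_mul (f : ℂ → ℂ) (c ζ : ℂ) {r : ℝ} (hr : 0 < r) :
    rayIntegral f c (r * ζ) = rayIntegral f c ζ := by
  have h := integral_comp_mul_left_Ioi (fun v : ℝ => r * ζ * f (c + v * ζ)) 0 hr
  rw [mul_zero] at h
  calc rayIntegral f c (r * ζ)
      = ∫ v in Ioi (0 : ℝ), r * ζ * f (c + (r * v : ℝ) * ζ) := by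
        refine integral_congr_ae (.of_forall fun v => ?_)
        push_cast
        ring_nf
    _ = rayIntegral f c ζ := by
        have hr' : (r : ℂ) ≠ 0 := by exact_mod_cast hr.ne'
        rw [h, rayIntegral, ← integral_smul]
        refine integral_congr_ae (.of_forall fun v => ?_)
        simp only [Complex.real_smul, Complex.ofReal_inv]
        field_simp

/-- Invariance under rescaling `ζ` makes the derivative vanish in the radial direction, hence in
every direction. -/
theorem rayIntegral_eq_of_differentiableOn {f : ℂ → ℂ} {c : ℂ} {U : Set ℂ} (hU : IsOpen U)
    (hU' : IsPreconnected U) (h0 : 0 ∉ U) (hf : DifferentiableOn ℂ (rayIntegral f c) U) {ζ ξ : ℂ}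
    (hζ : ζ ∈ U) (hξ : ξ ∈ U) : rayIntegral f c ζ = rayIntegral f c ξ := by
  have hderiv : U.EqOn (deriv (rayIntegral f c)) 0 := fun z hz => by
    have hz0 : z ≠ 0 := ne_of_mem_of_not_mem hz h0
    have hJ : HasDerivAt (rayIntegral f c) (deriv (rayIntegral f c) z) (((1 : ℝ) : ℂ) * z) := by
      simpa using (hf.differentiableAt (hU.mem_nhds hz)).hasDerivAt
    have hray : HasDerivAt (fun r : ℝ => (r : ℂ) * z) z 1 := by
      simpa using (hasDerivAt_id (1 : ℝ)).ofReal_comp.mul_const z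
    have hconst : HasDerivAt (fun r : ℝ => rayIntegral f c (r * z)) 0 1 :=
      (hasDerivAt_const _ (rayIntegral f c z)).congr_of_eventuallyEq
        ((lt_mem_nhds one_pos).mono fun r hr => rayIntegral_ofReal_mul f c z hr)
    have hcomp := HasDerivAt.comp (h₂ := rayIntegral f c) 1 hJ hray
    exact (mul_eq_zero.1 (hcomp.unique hconst)).resolve_right hz0
  obtain ⟨a, ha⟩ := hU.exists_is_const_of_deriv_eq_zero hU' hf hderiv
  rw [ha ζ hζ, ha ξ hξ]

end RayIntegral

section Bromwich

/-- The integrand, in the variable `s`, of the Bromwich integral that inverts the Laplace transform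
`s ↦ exp (-x s^α)` at `t`. -/
noncomputable def bromwichIntegrand (α t x : ℝ) (s : ℂ) : ℂ :=
  Complex.exp (t * s - x * s ^ (α : ℂ))

/-- The directions, up to scale, of the rays in the upper half-plane along which `exp (t s)`
decays. -/
def secondQuadrant : Set ℂ := {ζ | ζ.re < 0 ∧ 0 < ζ.im}

theorem isOpen_secondQuadrant : IsOpen secondQuadrant :=
  (isOpen_lt Complex.continuous_re continuous_const).inter
    (isOpen_lt continuous_const Complex.continuous_im)

theorem convex_secondQuadrant : Convex ℝ secondQuadrant :=
  (convex_halfSpace_re_lt 0).inter (convex_halfSpace_im_gt 0)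

theorem integrableOn_exp_neg_mul_exp_rpow {α k b : ℝ} (hα : 0 < α) (hα1 : α < 1) (hk : 0 < k)
    (hb : 0 < b) (c x : ℝ) :
    IntegrableOn (fun u : ℝ => Real.exp (-k * u) * Real.exp (x * (c + b * u) ^ α)) (Ioi 0) := by
  refine integrable_of_isBigO_exp_neg (half_pos hk) ?_ ?_
  · refine ContinuousOn.mul (by fun_prop) (Real.continuous_exp.comp_continuousOn ?_)
    exact continuousOn_const.mul (ContinuousOn.rpow_const (by fun_prop) fun _ _ => .inr hα.le)
  · have hlin : Tendsto (fun u => c + b * u) atTop atTop :=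
      tendsto_atTop_add_const_left _ c (tendsto_id.const_mul_atTop hb)
    have hsmall : Tendsto (fun u => x * (c + b * u) ^ (-(1 - α))) atTop (𝓝 0) := by
      simpa using ((tendsto_rpow_neg_atTop (sub_pos.2 hα1)).comp hlin).const_mul x
    refine Asymptotics.IsBigO.of_bound (Real.exp (k / 2 / b * c)) ?_
    filter_upwards [hsmall.eventually_le_const (by positivity : 0 < k / 2 / b),
      hlin.eventually_gt_atTop 0] with u hu hpos
    have hpow : x * (c + b * u) ^ α ≤ k / 2 / b * (c + b * u) := by
      have := mul_le_mul_of_nonneg_right hu hpos.le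
      rwa [mul_assoc, ← Real.rpow_add_one hpos.ne', neg_sub, sub_add_cancel] at this
    rw [← Real.exp_add, Real.norm_of_nonneg (Real.exp_pos _).le,
      Real.norm_of_nonneg (Real.exp_pos _).le, ← Real.exp_add, Real.exp_le_exp]
    have : k / 2 / b * (c + b * u) = k / 2 / b * c + k / 2 * u := by field_simp
    linarith

variable {α t : ℝ}

theorem norm_bromwichIntegrand (α t x : ℝ) (s : ℂ) :
    ‖bromwichIntegrand α t x s‖ = Real.exp (t * s.re - x * (s ^ (α : ℂ)).re) := by
  rw [bromwichIntegrand, Complex.norm_exp, Complex.sub_re, Complex.re_ofReal_mul,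
    Complex.re_ofReal_mul]

theorem norm_bromwichIntegrand_le (hα : 0 < α) (ht : 0 < t) (x : ℝ) {c v k R : ℝ} {ζ : ℂ}
    (hc : 0 ≤ c) (hv : 0 ≤ v) (hk : ζ.re ≤ -k) (hR : ‖ζ‖ ≤ R) :
    ‖bromwichIntegrand α t x (c + v * ζ)‖ ≤
      Real.exp (t * c) * (Real.exp (-(t * k) * v) * Real.exp (|x| * (c + R * v) ^ α)) := by
  have hnorm : ‖(c + v * ζ : ℂ)‖ ≤ c + R * v := by
    refine (norm_add_le _ _).trans ?_
    rw [norm_mul, Complex.norm_of_nonneg hc, Complex.norm_of_nonneg hv, mul_comm R]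
    gcongr
  have hpow : -(x * ((c + v * ζ : ℂ) ^ (α : ℂ)).re) ≤ |x| * (c + R * v) ^ α := by
    refine (neg_le_abs _).trans ?_
    rw [abs_mul]
    gcongr
    refine (Complex.abs_re_le_norm _).trans ?_
    rw [Complex.norm_cpow_real]
    gcongr
  have hre : t * (c + v * ζ : ℂ).re ≤ t * c + -(t * k) * v := by
    have hvk : v * ζ.re ≤ v * -k := by gcongr
    have := mul_le_mul_of_nonneg_left hvk ht.le
    simp only [Complex.add_re, Complex.ofReal_re, Complex.re_ofReal_mul]
    linarith
  rw [norm_bromwichIntegrand, ← Real.exp_add, ← Real.exp_add, Real.exp_le_exp]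
  linarith

@[fun_prop]
theorem measurable_bromwichIntegrand (α t : ℝ) {X : Type*} [MeasurableSpace X] {x : X → ℝ}
    {s : X → ℂ} (hx : Measurable x) (hs : Measurable s) :
    Measurable fun p => bromwichIntegrand α t (x p) (s p) := by
  unfold bromwichIntegrand
  fun_prop

theorem differentiableAt_bromwichIntegrand (α t x : ℝ) {s : ℂ} (hs : s ∈ Complex.slitPlane) :
    DifferentiableAt ℂ (bromwichIntegrand α t x) s := by
  have : DifferentiableAt ℂ (fun s : ℂ => s ^ (α : ℂ)) s := differentiableAt_id.cpow_const hs
  unfold bromwichIntegrand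
  fun_prop

theorem exists_integrableOn_bound_bromwichIntegrand (hα : 0 < α) (hα1 : α < 1) (ht : 0 < t)
    (x : ℝ) {c k R : ℝ} (hc : 0 ≤ c) (hk : 0 < k) (hR : 0 < R) :
    ∃ g : ℝ → ℝ, IntegrableOn g (Ioi 0) ∧ ∀ v : ℝ, 0 < v → ∀ ζ : ℂ, ζ.re ≤ -k → ‖ζ‖ ≤ R →
      ‖ζ * bromwichIntegrand α t x (c + v * ζ)‖ ≤ g v := by
  refine ⟨_, ((integrableOn_exp_neg_mul_exp_rpow hα hα1 (mul_pos ht hk) hR c |x|).const_mul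
    (Real.exp (t * c))).const_mul R, fun v hv ζ hζk hζR => ?_⟩
  rw [norm_mul]
  gcongr
  exact norm_bromwichIntegrand_le hα ht x hc hv.le hζk hζR

theorem differentiableOn_rayIntegral_bromwichIntegrand (hα : 0 < α) (hα1 : α < 1) (ht : 0 < t)
    (x : ℝ) {c : ℝ} (hc : 0 ≤ c) :
    DifferentiableOn ℂ (rayIntegral (bromwichIntegrand α t x) c) secondQuadrant := by
  refine differentiableOn_integral_of_locally_dominated isOpen_secondQuadrant
    (fun ζ _ => Measurable.aestronglyMeasurable (by fun_prop)) ?_ fun ζ hζ => ?_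
  · filter_upwards [self_mem_ae_restrict measurableSet_Ioi] with v (hv : 0 < v) ζ hζ
    have hs : (c + v * ζ : ℂ) ∈ Complex.slitPlane := .inr (by simp [hv.ne', hζ.2.ne'])
    exact (differentiableAt_id.mul (DifferentiableAt.comp (g := bromwichIntegrand α t x) ζ
      (differentiableAt_bromwichIntegrand α t x hs) (by fun_prop))).differentiableWithinAt
  · obtain ⟨g, hg, hbound⟩ := exists_integrableOn_bound_bromwichIntegrand hα hα1 ht x hc
      (k := -ζ.re / 2) (by linarith [hζ.1]) (R := ‖ζ‖ + 1) (by positivity)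
    refine ⟨g, hg, {w | w.re < ζ.re / 2} ∩ {w | ‖w‖ < ‖ζ‖ + 1}, IsOpen.mem_nhds
      ((isOpen_lt Complex.continuous_re continuous_const).inter
        (isOpen_lt continuous_norm continuous_const))
      ⟨show ζ.re < ζ.re / 2 by linarith [hζ.1], lt_add_one ‖ζ‖⟩, ?_⟩
    filter_upwards [self_mem_ae_restrict measurableSet_Ioi] with v hv w hw
    exact hbound v hv w ((le_of_lt hw.1).trans_eq (by ring)) hw.2.le

theorem continuousWithinAt_cpow_of_re_neg_of_im_zero (p : ℂ) {s : ℂ} (hs : s.re < 0)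
    (hs' : s.im = 0) : ContinuousWithinAt (fun z : ℂ => z ^ p) {z | 0 ≤ z.im} s := by
  have hlog := (Complex.continuousWithinAt_log_of_re_neg_of_im_zero hs hs').mul_const p
  have hs0 : s ≠ 0 := fun h => by simp [h] at hs
  refine (Complex.continuous_exp.continuousAt.comp_continuousWithinAt hlog).congr_of_eventuallyEq
    (eventually_nhdsWithin_of_eventually_nhds ((eventually_ne_nhds hs0).mono fun z hz => ?_)) ?_
  exacts [Complex.cpow_def_of_ne_zero hz p, Complex.cpow_def_of_ne_zero hs0 p]

theorem continuousWithinAt_bromwichIntegrand (hα : 0 < α) (t x : ℝ) (s : ℂ) (hs : 0 ≤ s.im) :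
    ContinuousWithinAt (bromwichIntegrand α t x) {z | 0 ≤ z.im} s := by
  have hpow : ContinuousWithinAt (fun z : ℂ => z ^ (α : ℂ)) {z | 0 ≤ z.im} s := by
    by_cases hslit : s ∈ Complex.slitPlane
    · exact (continuousAt_id.cpow continuousAt_const hslit).continuousWithinAt
    obtain ⟨hre, him⟩ := not_or.1 (mt Complex.mem_slitPlane_iff.2 hslit)
    rcases (not_lt.1 hre).eq_or_lt with hre | hre
    · obtain rfl : s = 0 := Complex.ext hre (not_not.1 him)
      exact (Complex.continuousAt_cpow_const_of_re_pos (.inl le_rfl)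
        (by simpa)).continuousWithinAt
    · exact continuousWithinAt_cpow_of_re_neg_of_im_zero _ hre (not_not.1 him)
  unfold bromwichIntegrand
  exact ((continuousWithinAt_const.mul continuousWithinAt_id).sub
    (continuousWithinAt_const.mul hpow)).cexp

/-- Rotating the ray onto the upper side of the branch cut. -/
theorem rayIntegral_bromwichIntegrand_eq (hα : 0 < α) (hα1 : α < 1) (ht : 0 < t)
    (x : ℝ) {c : ℝ} (hc : 0 ≤ c) {ζ : ℂ} (hζ : ζ ∈ secondQuadrant) :
    rayIntegral (bromwichIntegrand α t x) c ζ = rayIntegral (bromwichIntegrand α t x) c (-1) := by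
  have hconst : ∀ ξ ∈ secondQuadrant, rayIntegral (bromwichIntegrand α t x) c ξ =
      rayIntegral (bromwichIntegrand α t x) c ζ := fun ξ hξ =>
    rayIntegral_eq_of_differentiableOn isOpen_secondQuadrant convex_secondQuadrant.isPreconnected
      (fun h => lt_irrefl _ h.1)
      (differentiableOn_rayIntegral_bromwichIntegrand hα hα1 ht x hc) hξ hζ
  obtain ⟨g, hg, hbound⟩ := exists_integrableOn_bound_bromwichIntegrand hα hα1 ht x hc
    (k := 1 / 2) (by norm_num) (R := 2) (by norm_num)
  have hdir : Tendsto (fun ε : ℝ => (-1 + ε * Complex.I : ℂ)) (𝓝[>] 0) (𝓝 (-1)) :=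
    (Continuous.tendsto' (by fun_prop) _ _ (by simp)).mono_left nhdsWithin_le_nhds
  have hlim : Tendsto (fun ε : ℝ => rayIntegral (bromwichIntegrand α t x) c (-1 + ε * Complex.I))
      (𝓝[>] 0) (𝓝 (rayIntegral (bromwichIntegrand α t x) c (-1))) := by
    refine tendsto_integral_filter_of_dominated_convergence g
      (.of_forall fun _ => Measurable.aestronglyMeasurable (by fun_prop)) ?_ hg ?_
    · filter_upwards [Ioo_mem_nhdsGT one_pos] with ε hε
      filter_upwards [self_mem_ae_restrict measurableSet_Ioi] with v hv
      refine hbound v hv _ (by norm_num) ((norm_add_le _ _).trans ?_)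
      rw [norm_neg, norm_one, norm_mul, Complex.norm_I, mul_one, Complex.norm_of_nonneg hε.1.le]
      linarith [hε.2]
    · filter_upwards [self_mem_ae_restrict measurableSet_Ioi] with v (hv : 0 < v)
      refine hdir.mul ((continuousWithinAt_bromwichIntegrand hα t x _ (by simp)).tendsto.comp
        (tendsto_nhdsWithin_iff.2 ⟨(hdir.const_mul _).const_add _, ?_⟩))
      filter_upwards [self_mem_nhdsWithin] with ε (hε : 0 < ε)
      simp [(mul_pos hv hε).le]
  refine tendsto_nhds_unique (tendsto_const_nhds.congr' ?_) hlim
  filter_upwards [self_mem_nhdsWithin] with ε (hε : 0 < ε)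
  exact (hconst _ ⟨by simp, by simpa using hε⟩).symm

theorem im_bromwichIntegrand_neg (α t x : ℝ) {u : ℝ} (hu : 0 < u) :
    (-bromwichIntegrand α t x (-u : ℝ)).im = efrosKernelIntegrand α 0 t x u := by
  have hnorm : ‖((-u : ℝ) : ℂ)‖ = u := by
    rw [Complex.norm_real, norm_neg, Real.norm_of_nonneg hu.le]
  rw [bromwichIntegrand, Complex.neg_im, Complex.exp_im, Complex.sub_re, Complex.sub_im,
    Complex.re_ofReal_mul, Complex.im_ofReal_mul, Complex.re_ofReal_mul, Complex.im_ofReal_mul,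
    Complex.cpow_ofReal_re, Complex.cpow_ofReal_im, hnorm,
    Complex.arg_ofReal_of_neg (neg_neg_of_pos hu), efrosKernelIntegrand, Complex.ofReal_re,
    Complex.ofReal_im, mul_zero, zero_sub, Real.sin_neg, mul_zero, add_zero, Real.rpow_zero,
    one_mul, div_eq_mul_inv, ← Real.exp_neg]
  ring_nf

theorem im_bromwichIntegrand_ofReal (α t x : ℝ) {u : ℝ} (hu : 0 ≤ u) :
    (bromwichIntegrand α t x u).im = 0 := by
  rw [bromwichIntegrand, ← Complex.ofReal_cpow hu, ← Complex.ofReal_mul, ← Complex.ofReal_mul,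
    ← Complex.ofReal_sub, Complex.exp_ofReal_im]

theorem integrableOn_bromwichIntegrand (hα : 0 < α) (hα1 : α < 1) (ht : 0 < t) (x : ℝ) {c : ℝ}
    (hc : 0 ≤ c) {ζ : ℂ} (hζ : ζ.re < 0) :
    IntegrableOn (fun v : ℝ => ζ * bromwichIntegrand α t x (c + v * ζ)) (Ioi 0) := by
  have hζ0 : ζ ≠ 0 := fun h => by simp [h] at hζ
  obtain ⟨g, hg, hbound⟩ := exists_integrableOn_bound_bromwichIntegrand hα hα1 ht x hc
    (neg_pos.2 hζ) (norm_pos_iff.2 hζ0)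
  refine hg.mono' (Measurable.aestronglyMeasurable (by fun_prop)) ?_
  filter_upwards [self_mem_ae_restrict measurableSet_Ioi] with v hv
  exact hbound v hv ζ (neg_neg _).ge le_rfl

theorem integrableOn_efrosKernelIntegrand (hα : 0 < α) (hα1 : α < 1) (ht : 0 < t) (x : ℝ) :
    IntegrableOn (efrosKernelIntegrand α 0 t x) (Ioi 0) := by
  have h := integrableOn_bromwichIntegrand hα hα1 ht x le_rfl (ζ := -1) (by simp)
  refine IntegrableOn.congr_fun (f := fun u : ℝ => (-bromwichIntegrand α t x (-u : ℝ)).im) ?_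
    (fun u hu => im_bromwichIntegrand_neg α t x hu) measurableSet_Ioi
  rw [IntegrableOn] at h ⊢
  simpa using h.im

/-- On the negative real axis the ray integral is a real integral over the branch cut; the starting
point `c` is irrelevant because the integrand is real on `[0, c]`. -/
theorem efrosKernel_eq_im_rayIntegral (hα : 0 < α) (hα1 : α < 1) (ht : 0 < t) (x : ℝ) {c : ℝ}
    (hc : 0 ≤ c) {ζ : ℂ} (hζ : ζ ∈ secondQuadrant) :
    efrosKernel α 0 t x = Real.pi⁻¹ * (rayIntegral (bromwichIntegrand α t x) c ζ).im := by
  set H : ℝ → ℝ := fun u => (-bromwichIntegrand α t x (-u : ℝ)).im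
  have hH (u : ℝ) (hu : u ≤ 0) : H u = 0 := by
    simp only [H, Complex.neg_im, im_bromwichIntegrand_ofReal α t x (neg_nonneg.2 hu), neg_zero]
  rw [rayIntegral_bromwichIntegrand_eq hα hα1 ht x hc hζ, efrosKernel, if_neg zero_ne_one, add_zero,
    rayIntegral]
  congr 1
  symm
  calc (∫ v in Ioi (0 : ℝ), -1 * bromwichIntegrand α t x (c + v * -1)).im
      = ∫ v in Ioi (0 : ℝ), (-1 * bromwichIntegrand α t x (c + v * -1)).im :=
        (integral_im (integrableOn_bromwichIntegrand hα hα1 ht x hc (by simp))).symm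
    _ = ∫ v in Ioi (0 : ℝ), H (v - c) := by
        congr 1 with v
        simp only [H]
        push_cast
        ring_nf
    _ = ∫ v, H (v - c) := setIntegral_eq_integral_of_forall_compl_eq_zero fun v hv =>
        hH _ (by linarith [notMem_Ioi.1 hv])
    _ = ∫ u, H u := integral_sub_right_eq_self H c
    _ = ∫ u in Ioi 0, H u := (setIntegral_eq_integral_of_forall_compl_eq_zero fun u hu =>
        hH u (notMem_Ioi.1 hu)).symm
    _ = ∫ u in Ioi 0, efrosKernelIntegrand α 0 t x u :=
        setIntegral_congr_fun measurableSet_Ioi fun u hu => im_bromwichIntegrand_neg α t x hu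

theorem exists_mem_secondQuadrant_mul_arg_lt (hα : 0 < α) (hα1 : α < 1) :
    ∃ ζ ∈ secondQuadrant, α * ζ.arg < Real.pi / 2 := by
  have hπ := Real.pi_pos
  have hlt : Real.pi / 2 < min Real.pi (Real.pi / 2 / α) := by
    rw [lt_min_iff, lt_div_iff₀ hα]
    exact ⟨half_lt_self hπ, mul_lt_of_lt_one_right (by positivity) hα1⟩
  obtain ⟨φ, hφ, hφ'⟩ := exists_between hlt
  rw [lt_min_iff, lt_div_iff₀' hα] at hφ'
  refine ⟨Complex.exp (φ * Complex.I), ⟨?_, ?_⟩, ?_⟩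
  · rw [Complex.exp_ofReal_mul_I_re]
    exact Real.cos_neg_of_pi_div_two_lt_of_lt hφ (by linarith)
  · rw [Complex.exp_ofReal_mul_I_im]
    exact Real.sin_pos_of_pos_of_lt_pi (by linarith) hφ'.1
  · rw [Complex.arg_exp_mul_I, (toIocMod_eq_self _).2 ⟨by linarith, by linarith⟩]
    exact hφ'.2

theorem arg_ofReal_add_ofReal_mul_mem_Icc {c v : ℝ} {ζ : ℂ} (hc : 0 ≤ c) (hv : 0 ≤ v)
    (hζ : ζ ∈ secondQuadrant) : (c + v * ζ : ℂ).arg ∈ Icc 0 ζ.arg := by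
  set s : ℂ := c + v * ζ
  have hζ0 : ζ ≠ 0 := fun h => by simpa [h] using hζ.2
  have hsre : s.re = c + v * ζ.re := by simp [s]
  have hs : 0 ≤ s.arg := Complex.arg_nonneg_iff.2 (by simpa [s] using mul_nonneg hv hζ.2.le)
  refine ⟨hs, ?_⟩
  rcases eq_or_ne s 0 with h0 | h0
  · rw [h0, Complex.arg_zero]
    exact Complex.arg_nonneg_iff.2 hζ.2.le
  have hnorm : v * ‖ζ‖ - c ≤ ‖s‖ := by
    have := norm_sub_norm_le ((v : ℂ) * ζ) (-(c : ℂ))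
    rwa [norm_mul, norm_neg, Complex.norm_of_nonneg hv, Complex.norm_of_nonneg hc, sub_neg_eq_add,
      add_comm _ (c : ℂ)] at this
  have hre : ζ.re * ‖s‖ ≤ s.re * ‖ζ‖ := by
    have h1 := mul_le_mul_of_nonpos_left hnorm hζ.1.le
    have h2 := mul_le_mul_of_nonneg_left ((neg_le_abs _).trans (Complex.abs_re_le_norm ζ)) hc
    rw [hsre]
    linarith
  rwa [← Real.strictAntiOn_cos.le_iff_ge ⟨Complex.arg_nonneg_iff.2 hζ.2.le, Complex.arg_le_pi _⟩
    ⟨hs, Complex.arg_le_pi _⟩, Complex.cos_arg hζ0, Complex.cos_arg h0,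
    div_le_div_iff₀ (norm_pos_iff.2 hζ0) (norm_pos_iff.2 h0)]

theorem mul_im_le_norm_mul_norm (c v : ℝ) (ζ : ℂ) : c * ζ.im ≤ ‖(c + v * ζ : ℂ)‖ * ‖ζ‖ := by
  have h := (neg_le_abs _).trans (Complex.abs_im_le_norm ((c + v * ζ : ℂ) * starRingEnd ℂ ζ))
  simp only [norm_mul, RCLike.norm_conj, Complex.mul_im, Complex.add_re, Complex.add_im,
    Complex.ofReal_re, Complex.ofReal_im, Complex.re_ofReal_mul,
    Complex.conj_re, Complex.conj_im] at h
  linarith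

theorem cos_mul_arg_pos (hα : 0 < α) {ζ : ℂ} (hζ : ζ ∈ secondQuadrant)
    (harg : α * ζ.arg < Real.pi / 2) : 0 < Real.cos (α * ζ.arg) := by
  have : 0 ≤ α * ζ.arg := mul_nonneg hα.le (Complex.arg_nonneg_iff.2 hζ.2.le)
  exact Real.cos_pos_of_mem_Ioo ⟨by linarith [Real.pi_pos], harg⟩

theorem le_re_cpow_ofReal_add_ofReal_mul (hα : 0 < α) {c v : ℝ} {ζ : ℂ} (hc : 0 ≤ c) (hv : 0 ≤ v)
    (hζ : ζ ∈ secondQuadrant) (harg : α * ζ.arg < Real.pi / 2) :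
    (c * (ζ.im / ‖ζ‖)) ^ α * Real.cos (α * ζ.arg) ≤ ((c + v * ζ : ℂ) ^ (α : ℂ)).re := by
  obtain ⟨h0, hle⟩ := arg_ofReal_add_ofReal_mul_mem_Icc hc hv hζ
  have hζ0 : 0 < ‖ζ‖ := norm_pos_iff.2 fun h => by simpa [h] using hζ.2
  have him := hζ.2
  have hcos := cos_mul_arg_pos hα hζ harg
  have hnorm : c * (ζ.im / ‖ζ‖) ≤ ‖(c + v * ζ : ℂ)‖ := by
    rw [← mul_div_assoc, div_le_iff₀ hζ0]
    exact mul_im_le_norm_mul_norm c v ζ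
  rw [Complex.cpow_ofReal_re, mul_comm (Complex.arg _)]
  refine mul_le_mul (Real.rpow_le_rpow (by positivity) hnorm hα.le) ?_ hcos.le (by positivity)
  exact Real.cos_le_cos_of_nonneg_of_le_pi (by positivity) (by linarith [Real.pi_pos])
    (by gcongr)

/-- Moving the starting point of the rays to the right gives any rate of decay. -/
theorem abs_efrosKernel_le (hα : 0 < α) (hα1 : α < 1) (ht : 0 < t) (κ : ℝ) :
    ∃ C, ∀ x, 0 ≤ x → |efrosKernel α 0 t x| ≤ C * Real.exp (-κ * x) := by
  obtain ⟨ζ, hζ, harg⟩ := exists_mem_secondQuadrant_mul_arg_lt hα hα1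
  have hζ0 : 0 < ‖ζ‖ := norm_pos_iff.2 fun h => by simpa [h] using hζ.2
  obtain ⟨c, hκ, hc⟩ : ∃ c, κ ≤ (c * (ζ.im / ‖ζ‖)) ^ α * Real.cos (α * ζ.arg) ∧ 0 ≤ c := by
    have hlim := ((tendsto_rpow_atTop hα).comp (tendsto_id.atTop_mul_const
      (div_pos hζ.2 hζ0))).atTop_mul_const (cos_mul_arg_pos hα hζ harg)
    exact ((hlim.eventually_ge_atTop κ).and (eventually_ge_atTop 0)).exists
  have hbound (x : ℝ) (hx : 0 ≤ x) (v : ℝ) (hv : 0 ≤ v) :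
      ‖ζ * bromwichIntegrand α t x (c + v * ζ)‖ ≤
        ‖ζ‖ * Real.exp (t * c) * Real.exp (t * ζ.re * v) * Real.exp (-κ * x) := by
    have hre := mul_le_mul_of_nonneg_left
      (hκ.trans (le_re_cpow_ofReal_add_ofReal_mul hα hc hv hζ harg)) hx
    rw [norm_mul, norm_bromwichIntegrand, mul_assoc, mul_assoc, ← Real.exp_add, ← Real.exp_add]
    gcongr
    simp only [Complex.add_re, Complex.ofReal_re, Complex.re_ofReal_mul]
    linarith
  have hint : IntegrableOn (fun v : ℝ => Real.exp (t * ζ.re * v)) (Ioi 0) :=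
    integrableOn_exp_mul_Ioi (mul_neg_of_pos_of_neg ht hζ.1) 0
  refine ⟨Real.pi⁻¹ * (‖ζ‖ * Real.exp (t * c) * ∫ v in Ioi (0 : ℝ), Real.exp (t * ζ.re * v)),
    fun x hx => ?_⟩
  rw [efrosKernel_eq_im_rayIntegral hα hα1 ht x hc hζ, abs_mul,
    abs_of_pos (inv_pos.2 Real.pi_pos), mul_assoc]
  gcongr
  refine (Complex.abs_im_le_norm _).trans ?_
  rw [← integral_const_mul, ← integral_mul_const]
  refine norm_integral_le_of_norm_le ((hint.const_mul _).mul_const _) ?_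
  filter_upwards [self_mem_ae_restrict measurableSet_Ioi] with v hv
  exact hbound x hx v (le_of_lt hv)

@[fun_prop]
theorem measurable_efrosKernel (a b t : ℝ) : Measurable (efrosKernel a b t) := by
  have : Measurable fun p : ℝ × ℝ => efrosKernelIntegrand a b t p.1 p.2 := by
    unfold efrosKernelIntegrand
    fun_prop
  exact ((this.stronglyMeasurable.integral_prod_right).measurable.const_mul _).add_const _

end Bromwich

section Moments

variable {α t : ℝ}

theorem ofReal_mul_cpow {r : ℝ} (hr : 0 < r) {z : ℂ} (hz : z ≠ 0) (w : ℂ) :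
    (r * z : ℂ) ^ w = (r : ℂ) ^ w * z ^ w := by
  have hr' : (r : ℂ) ≠ 0 := by exact_mod_cast hr.ne'
  rw [Complex.cpow_def_of_ne_zero (mul_ne_zero hr' hz), Complex.cpow_def_of_ne_zero hr',
    Complex.cpow_def_of_ne_zero hz, Complex.log_ofReal_mul hr hz, add_mul, Complex.exp_add,
    Complex.ofReal_log hr.le]

theorem neg_cpow_of_im_pos {z : ℂ} (hz : 0 < z.im) (w : ℂ) :
    (-z) ^ w = z ^ w * Complex.exp (-(Real.pi * Complex.I) * w) := by
  have hz0 : z ≠ 0 := fun h => by simp [h] at hz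
  have hlog : Complex.log (-z) = Complex.log z - Real.pi * Complex.I := by
    simp only [Complex.log, norm_neg, Complex.arg_neg_eq_arg_sub_pi_of_im_pos hz]
    push_cast
    ring
  rw [Complex.cpow_def_of_ne_zero (neg_ne_zero.2 hz0), Complex.cpow_def_of_ne_zero hz0, hlog,
    ← Complex.exp_add]
  ring_nf

theorem rayIntegral_exp_mul_cpow_neg {z : ℝ} (hz : z < 1) (ht : 0 < t) {ζ : ℂ}
    (hζ : ζ ∈ secondQuadrant) :
    rayIntegral (fun s => Complex.exp (t * s) * s ^ (-(z : ℂ))) 0 ζ =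
      (Real.Gamma (1 - z) * t ^ (z - 1) : ℝ) *
        Complex.exp ((Real.pi * (1 - z) : ℝ) * Complex.I) := by
  have hζ0 : ζ ≠ 0 := fun h => by simpa [h] using hζ.2
  have hre : 0 < (t * -ζ).re := by simpa using mul_neg_of_pos_of_neg ht hζ.1
  have hrate : (t * -ζ : ℂ) ^ (-((1 - z : ℝ) : ℂ)) = ((t ^ (z - 1) : ℝ) : ℂ) *
      (ζ ^ (z - 1 : ℂ) * Complex.exp ((Real.pi * (1 - z) : ℝ) * Complex.I)) := by
    rw [ofReal_mul_cpow ht (neg_ne_zero.2 hζ0), neg_cpow_of_im_pos hζ.2, Complex.ofReal_cpow ht.le]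
    push_cast
    ring_nf
  have hcancel : ζ * ζ ^ (-(z : ℂ)) * ζ ^ (z - 1 : ℂ) = 1 := by
    nth_rewrite 1 [← Complex.cpow_one ζ]
    rw [← Complex.cpow_add _ _ hζ0, ← Complex.cpow_add _ _ hζ0,
      show 1 + -(z : ℂ) + (z - 1) = 0 by ring, Complex.cpow_zero]
  calc rayIntegral (fun s => Complex.exp (t * s) * s ^ (-(z : ℂ))) 0 ζ
      = ∫ v in Ioi (0 : ℝ), ζ * ζ ^ (-(z : ℂ)) *
          (((v ^ (1 - z - 1) : ℝ) : ℂ) * Complex.exp (-(t * -ζ * v))) := by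
        refine setIntegral_congr_fun measurableSet_Ioi fun v (hv : 0 < v) => ?_
        simp only [zero_add]
        rw [ofReal_mul_cpow hv hζ0, ← Complex.ofReal_neg, ← Complex.ofReal_cpow hv.le]
        ring_nf
    _ = (Real.Gamma (1 - z) * t ^ (z - 1) : ℝ) *
          Complex.exp ((Real.pi * (1 - z) : ℝ) * Complex.I) *
            (ζ * ζ ^ (-(z : ℂ)) * ζ ^ (z - 1 : ℂ)) := by
        rw [integral_const_mul, integral_rpow_mul_cexp_neg (sub_pos.2 hz) hre, hrate,
          Complex.ofReal_mul (Real.Gamma _)]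
        ring
    _ = _ := by rw [hcancel, mul_one]

theorem im_rayIntegral_exp_mul_cpow_neg {z : ℝ} (hz : z ∈ Ioo 0 1) (ht : 0 < t) {ζ : ℂ}
    (hζ : ζ ∈ secondQuadrant) :
    (rayIntegral (fun s => Complex.exp (t * s) * s ^ (-(z : ℂ))) 0 ζ).im =
      Real.pi * rlKernel z t := by
  have hsin : Real.sin (Real.pi * (1 - z)) = Real.sin (Real.pi * z) := by
    rw [mul_sub, mul_one, Real.sin_pi_sub]
  have hsin_pos : 0 < Real.sin (Real.pi * z) := Real.sin_pos_of_pos_of_lt_pi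
    (mul_pos Real.pi_pos hz.1) (mul_lt_of_lt_one_right Real.pi_pos hz.2)
  have hreflection := Real.Gamma_mul_Gamma_one_sub z
  have hG := (Real.Gamma_pos_of_pos hz.1).ne'
  rw [rayIntegral_exp_mul_cpow_neg hz.2 ht hζ, Complex.im_ofReal_mul, Complex.exp_ofReal_mul_I_im,
    hsin, rlKernel]
  rw [eq_div_iff hsin_pos.ne'] at hreflection
  generalize Real.sin (Real.pi * z) = S at hreflection ⊢
  field_simp
  linear_combination hreflection

theorem integral_rpow_mul_bromwichIntegrand {a : ℝ} (ha : 0 < a) {s : ℂ}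
    (hs : 0 < (s ^ (α : ℂ)).re) (harg : α * s.arg ∈ Ioc (-Real.pi) Real.pi) (t : ℝ) :
    ∫ x in Ioi (0 : ℝ), ((x ^ (a - 1) : ℝ) : ℂ) * bromwichIntegrand α t x s =
      Real.Gamma a * (Complex.exp (t * s) * s ^ (-((α * a : ℝ) : ℂ))) := by
  have him : (Complex.log s * (α : ℂ)).im = α * s.arg := by
    rw [Complex.im_mul_ofReal, Complex.log_im, mul_comm]
  have hpow : s ^ (-((α * a : ℝ) : ℂ)) = (s ^ (α : ℂ)) ^ (-(a : ℂ)) := by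
    rw [← Complex.cpow_mul _ (by rw [him]; exact harg.1) (by rw [him]; exact harg.2)]
    push_cast
    ring_nf
  rw [hpow, mul_left_comm, ← integral_rpow_mul_cexp_neg ha hs, ← integral_const_mul]
  refine integral_congr_ae (.of_forall fun x => ?_)
  simp only [bromwichIntegrand, sub_eq_add_neg, Complex.exp_add, mul_comm (x : ℂ)]
  ring

theorem mul_arg_mem_Ioc (hα : 0 < α) (hα1 : α < 1) {s : ℂ} (hs : 0 ≤ s.im) :
    α * s.arg ∈ Ioc (-Real.pi) Real.pi := by
  have h0 : 0 ≤ s.arg := Complex.arg_nonneg_iff.2 hs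
  exact ⟨(neg_neg_of_pos Real.pi_pos).trans_le (mul_nonneg hα.le h0),
    (mul_le_of_le_one_left h0 hα1.le).trans (Complex.arg_le_pi s)⟩

theorem integrable_rpow_mul_bromwichIntegrand {a : ℝ} (ha : 0 < a) (haα : α * a < 1) (ht : 0 < t)
    {ζ : ℂ} (hζ : ζ ∈ secondQuadrant) (hre : 0 < (ζ ^ (α : ℂ)).re) :
    Integrable (fun p : ℝ × ℝ =>
        ((p.2 ^ (a - 1) : ℝ) : ℂ) * (ζ * bromwichIntegrand α t p.2 (p.1 * ζ)))
      ((volume.restrict (Ioi 0)).prod (volume.restrict (Ioi 0))) := by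
  have hζ0 : ζ ≠ 0 := fun h => by simpa [h] using hζ.2
  set k : ℝ := (ζ ^ (α : ℂ)).re
  have hnorm {v x : ℝ} (hv : 0 < v) (hx : 0 < x) :
      ‖((x ^ (a - 1) : ℝ) : ℂ) * (ζ * bromwichIntegrand α t x (v * ζ))‖ =
        ‖ζ‖ * Real.exp (t * ζ.re * v) * (x ^ (a - 1) * Real.exp (-(v ^ α * k * x))) := by
    rw [norm_mul, norm_mul, Complex.norm_of_nonneg (by positivity), norm_bromwichIntegrand,
      ofReal_mul_cpow hv hζ0, ← Complex.ofReal_cpow hv.le, Complex.re_ofReal_mul,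
      Complex.re_ofReal_mul, Real.exp_sub, Real.exp_neg]
    simp only [k]
    ring_nf
  have hmeas : Measurable fun p : ℝ × ℝ =>
      ((p.2 ^ (a - 1) : ℝ) : ℂ) * (ζ * bromwichIntegrand α t p.2 (p.1 * ζ)) := by fun_prop
  refine (integrable_prod_iff hmeas.aestronglyMeasurable).2 ⟨?_, ?_⟩
  · filter_upwards [self_mem_ae_restrict measurableSet_Ioi] with v (hv : 0 < v)
    refine ((integrableOn_rpow_mul_exp_neg (p := a - 1) (k := v ^ α * k) (by linarith)
      (by positivity)).const_mul (‖ζ‖ * Real.exp (t * ζ.re * v))).mono'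
      (Measurable.aestronglyMeasurable (by fun_prop)) ?_
    filter_upwards [self_mem_ae_restrict measurableSet_Ioi] with x hx
    rw [hnorm hv hx, neg_mul]
  · refine IntegrableOn.congr_fun ((integrableOn_rpow_mul_exp_neg (p := -(α * a)) (by linarith)
      (mul_pos ht (neg_pos.2 hζ.1))).const_mul (‖ζ‖ * (k ^ (-a) * Real.Gamma a)))
      (fun v (hv : 0 < v) => ?_) measurableSet_Ioi
    simp only
    rw [setIntegral_congr_fun measurableSet_Ioi fun x (hx : 0 < x) => hnorm hv hx,
      integral_const_mul, Real.integral_rpow_mul_exp_neg_mul_Ioi ha (by positivity), one_div,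
      Real.inv_rpow (by positivity), ← Real.rpow_neg (by positivity), Real.mul_rpow (by positivity)
      (by positivity), ← Real.rpow_mul hv.le]
    ring_nf

theorem integral_rpow_mul_efrosKernel_of_mul_lt_one (hα : 0 < α) (hα1 : α < 1) {a : ℝ} (ha : 0 < a)
    (haα : α * a < 1) (ht : 0 < t) :
    ∫ x in Ioi 0, x ^ (a - 1) * efrosKernel α 0 t x = Real.Gamma a * rlKernel (α * a) t := by
  obtain ⟨ζ, hζ, harg⟩ := exists_mem_secondQuadrant_mul_arg_lt hα hα1
  have hζ0 : ζ ≠ 0 := fun h => by simpa [h] using hζ.2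
  have hreζ : 0 < (ζ ^ (α : ℂ)).re := by
    rw [Complex.cpow_ofReal_re, mul_comm ζ.arg]
    exact mul_pos (by positivity) (cos_mul_arg_pos hα hζ harg)
  have hre {v : ℝ} (hv : 0 < v) : 0 < ((v * ζ : ℂ) ^ (α : ℂ)).re := by
    rw [ofReal_mul_cpow hv hζ0, ← Complex.ofReal_cpow hv.le, Complex.re_ofReal_mul]
    positivity
  have hint := integrable_rpow_mul_bromwichIntegrand ha haα ht hζ hreζ
  calc ∫ x in Ioi 0, x ^ (a - 1) * efrosKernel α 0 t x
      = Real.pi⁻¹ * ∫ x in Ioi (0 : ℝ), (∫ v in Ioi (0 : ℝ),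
          ((x ^ (a - 1) : ℝ) : ℂ) * (ζ * bromwichIntegrand α t x (v * ζ))).im := by
        rw [← integral_const_mul]
        congr 1 with x
        rw [efrosKernel_eq_im_rayIntegral hα hα1 ht x le_rfl hζ, integral_const_mul,
          Complex.im_ofReal_mul, rayIntegral]
        simp only [Complex.ofReal_zero, zero_add]
        ring
    _ = Real.pi⁻¹ * (∫ v in Ioi (0 : ℝ), ∫ x in Ioi (0 : ℝ),
          ((x ^ (a - 1) : ℝ) : ℂ) * (ζ * bromwichIntegrand α t x (v * ζ))).im := by
        congr 1
        refine (integral_im hint.integral_prod_right).trans (congrArg _ ?_)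
        exact (integral_integral_swap hint).symm
    _ = Real.pi⁻¹ * (Real.Gamma a * rayIntegral
          (fun s => Complex.exp (t * s) * s ^ (-((α * a : ℝ) : ℂ))) 0 ζ).im := by
        rw [rayIntegral, ← integral_const_mul]
        congr 2
        refine setIntegral_congr_fun measurableSet_Ioi fun v (hv : 0 < v) => ?_
        simp only [mul_left_comm _ ζ, zero_add]
        rw [integral_const_mul, integral_rpow_mul_bromwichIntegrand ha (hre hv)
          (mul_arg_mem_Ioc hα hα1 (by simpa using (mul_pos hv hζ.2).le))]
    _ = Real.Gamma a * rlKernel (α * a) t := by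
        rw [Complex.im_ofReal_mul, im_rayIntegral_exp_mul_cpow_neg ⟨mul_pos hα ha, haα⟩ ht hζ]
        field_simp

theorem exists_abs_efrosKernel_mul_exp_le (hα : 0 < α) (hα1 : α < 1) (ht : 0 < t) (μ κ : ℝ) :
    ∃ C, ∀ x, 0 ≤ x → |efrosKernel α 0 t x * Real.exp (μ * x)| ≤ C * Real.exp (-κ * x) := by
  obtain ⟨C, hC⟩ := abs_efrosKernel_le hα hα1 ht (μ + κ)
  refine ⟨C, fun x hx => ?_⟩
  rw [abs_mul, Real.abs_exp]
  calc |efrosKernel α 0 t x| * Real.exp (μ * x)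
      ≤ C * Real.exp (-(μ + κ) * x) * Real.exp (μ * x) := by gcongr; exact hC x hx
    _ = C * Real.exp (-κ * x) := by rw [mul_assoc, ← Real.exp_add]; ring_nf

theorem integrableOn_efrosKernel_mul_exp (hα : 0 < α) (hα1 : α < 1) (ht : 0 < t) (μ : ℝ) :
    IntegrableOn (fun x => efrosKernel α 0 t x * Real.exp (μ * x)) (Ioi 0) := by
  obtain ⟨C, hC⟩ := exists_abs_efrosKernel_mul_exp_le hα hα1 ht μ 1
  refine ((exp_neg_integrableOn_Ioi 0 one_pos).const_mul C).mono'
    (Measurable.aestronglyMeasurable (by fun_prop)) ?_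
  filter_upwards [self_mem_ae_restrict measurableSet_Ioi] with x hx using hC x (le_of_lt hx)

theorem isBigO_atTop_efrosKernel_mul_exp (hα : 0 < α) (hα1 : α < 1) (ht : 0 < t) (μ q : ℝ) :
    (fun x => efrosKernel α 0 t x * Real.exp (μ * x)) =O[atTop] (· ^ (-q)) := by
  obtain ⟨C, hC⟩ := exists_abs_efrosKernel_mul_exp_le hα hα1 ht μ 1
  refine (Asymptotics.IsBigO.of_bound C ?_).trans
    (isLittleO_exp_neg_mul_rpow_atTop one_pos _).isBigO
  filter_upwards [eventually_ge_atTop 0] with x hx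
  simpa using hC x hx

theorem isBigO_nhdsGT_zero_efrosKernel_mul_exp (hα : 0 < α) (hα1 : α < 1) (ht : 0 < t) (μ : ℝ) :
    (fun x => efrosKernel α 0 t x * Real.exp (μ * x)) =O[𝓝[>] 0] (· ^ (-(0 : ℝ))) := by
  obtain ⟨C, hC⟩ := exists_abs_efrosKernel_mul_exp_le hα hα1 ht μ 0
  refine Asymptotics.IsBigO.of_bound C ?_
  filter_upwards [self_mem_nhdsWithin] with x hx
  simpa using hC x (le_of_lt hx)

theorem mellin_efrosKernel (hα : 0 < α) (hα1 : α < 1) (ht : 0 < t) {s : ℂ} (hs : 0 < s.re) :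
    mellin (fun x => (efrosKernel α 0 t x : ℂ)) s =
      Complex.Gamma s * ((t : ℂ) ^ (α * s - 1) * (Complex.Gamma (α * s))⁻¹) := by
  have hleft : DifferentiableOn ℂ (mellin fun x => (efrosKernel α 0 t x : ℂ)) {s | 0 < s.re} := by
    intro s hs
    have hint := integrableOn_efrosKernel_mul_exp hα hα1 ht 0
    have htop := isBigO_atTop_efrosKernel_mul_exp hα hα1 ht 0 (s.re + 1)
    have hbot := isBigO_nhdsGT_zero_efrosKernel_mul_exp hα hα1 ht 0
    simp only [zero_mul, Real.exp_zero, mul_one] at hint htop hbot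
    exact (mellin_differentiableAt_of_isBigO_rpow
      (IntegrableOn.locallyIntegrableOn (Integrable.ofReal (𝕜 := ℂ) hint))
      (Complex.isBigO_ofReal_left.2 htop) (lt_add_one _)
      (Complex.isBigO_ofReal_left.2 hbot) hs).differentiableWithinAt
  have hright : DifferentiableOn ℂ (fun s => Complex.Gamma s *
      ((t : ℂ) ^ (α * s - 1) * (Complex.Gamma (α * s))⁻¹)) {s | 0 < s.re} := by
    intro s hs
    have hΓ := Complex.differentiableAt_Gamma s fun m h => by
      simp only [h, mem_ofPred_eq, Complex.neg_re, Complex.natCast_re] at hs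
      linarith [m.cast_nonneg (α := ℝ)]
    have hpow : DifferentiableAt ℂ (fun s : ℂ => (t : ℂ) ^ (α * s - 1)) s :=
      DifferentiableAt.const_cpow (by fun_prop) (.inl (by exact_mod_cast ht.ne'))
    have hinv : DifferentiableAt ℂ (fun s : ℂ => (Complex.Gamma (α * s))⁻¹) s :=
      (Complex.differentiable_one_div_Gamma _).comp s (differentiableAt_id.const_mul (α : ℂ))
    exact (hΓ.mul (hpow.mul hinv)).differentiableWithinAt
  refine eqOn_re_pos_of_eq_ofReal le_rfl one_pos hleft hright (fun a ha => ?_) hs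
  rw [mellin_ofReal, integral_rpow_mul_efrosKernel_of_mul_lt_one hα hα1 ha.1
    (mul_lt_one_of_nonneg_of_lt_one_left hα.le hα1 ha.2.le) ht, rlKernel]
  push_cast [Complex.ofReal_cpow ht.le, ← Complex.Gamma_ofReal]
  rw [div_eq_mul_inv]

theorem integral_rlKernel_mul_efrosKernel (hα : 0 < α) (hα1 : α < 1) (ht : 0 < t) {a : ℝ}
    (ha : 0 < a) : ∫ x in Ioi 0, rlKernel a x * efrosKernel α 0 t x = rlKernel (α * a) t := by
  have hmellin := mellin_efrosKernel hα hα1 ht (s := (a : ℂ)) ha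
  rw [mellin_ofReal, Complex.Gamma_ofReal, ← Complex.ofReal_mul, Complex.Gamma_ofReal,
    ← Complex.ofReal_one, ← Complex.ofReal_sub, ← Complex.ofReal_cpow ht.le,
    ← Complex.ofReal_inv, ← Complex.ofReal_mul, ← Complex.ofReal_mul, Complex.ofReal_inj,
    ← div_eq_mul_inv] at hmellin
  simp only [rlKernel, div_mul_eq_mul_div]
  rw [integral_div, hmellin, mul_div_cancel_left₀ _ (Real.Gamma_pos_of_pos ha).ne']

theorem integral_rlKernelDeriv_mul_efrosKernel (hα : 0 < α) (hα1 : α < 1) (ht : 0 < t) {a : ℝ}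
    (ha : 0 < a) :
    IntegrableOn (fun x => rlKernel a x * efrosKernel α 0 t x) (Ioi 0) ∧
      IntegrableOn (fun x => rlKernelDeriv a x * efrosKernel α 0 t x) (Ioi 0) ∧
      ∫ x in Ioi 0, rlKernelDeriv a x * efrosKernel α 0 t x = α * rlKernelDeriv (α * a) t := by
  have hint := integrableOn_efrosKernel_mul_exp hα hα1 ht 0
  have htop := isBigO_atTop_efrosKernel_mul_exp hα hα1 ht 0 (a + 1)
  have hbot := isBigO_nhdsGT_zero_efrosKernel_mul_exp hα hα1 ht 0
  simp only [zero_mul, Real.exp_zero, mul_one] at hint htop hbot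
  refine integral_rlKernelDeriv_mul ha hint.locallyIntegrableOn htop (lt_add_one a) hbot ha
    ((lt_mem_nhds ha).mono fun s hs => integral_rlKernel_mul_efrosKernel hα hα1 ht hs) ?_
  rw [mul_comm]
  exact (hasDerivAt_rlKernel (mul_pos hα ha) ht).comp a (hasDerivAt_const_mul α)

end Moments

section EfrosTransform

variable {α t : ℝ}

theorem hasSum_integral_mul_exp {μ : Measure ℝ} {g : ℝ → ℝ} {lam : ℝ}
    (hg : AEStronglyMeasurable g μ) (hint : Integrable (fun x => g x * Real.exp |lam * x|) μ) :
    HasSum (fun n : ℕ => lam ^ n * ∫ x, x ^ n / n.factorial * g x ∂μ)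
      (∫ x, Real.exp (lam * x) * g x ∂μ) := by
  have hexp (y : ℝ) : HasSum (fun n : ℕ => y ^ n / n.factorial) (Real.exp y) := by
    rw [Real.exp_eq_exp_ℝ]
    exact NormedSpace.expSeries_div_hasSum_exp y
  have hnorm (x : ℝ) : HasSum (fun n : ℕ => |lam * x| ^ n / n.factorial * |g x|)
      ‖g x * Real.exp |lam * x|‖ := by
    rw [norm_mul, Real.norm_eq_abs, Real.norm_eq_abs, Real.abs_exp, mul_comm |g x|]
    exact (hexp _).mul_right _
  simp only [← integral_const_mul]
  refine hasSum_integral_of_dominated_convergence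
    (fun (n : ℕ) x => |lam * x| ^ n / n.factorial * |g x|) (fun n => by fun_prop)
    (fun n => .of_forall fun x => ?_) (.of_forall fun x => (hnorm x).summable) ?_
    (.of_forall fun x => ?_)
  · simp only [norm_mul, norm_div, norm_pow, Real.norm_eq_abs, abs_mul, mul_pow, Nat.abs_cast]
    exact (by ring : _ = _).le
  · simpa only [(hnorm _).tsum_eq] using hint.norm
  · refine ((hexp (lam * x)).mul_right (g x)).congr_fun fun n => ?_
    ring

/-- The coefficient of `lam ^ n` in the integral of `exp (lam * x) * (log x + γ₀)` against the
kernel `Φ_{α,0}(t, x)`. -/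
noncomputable def efrosTerm (α : ℝ) (n : ℕ) (t : ℝ) : ℝ :=
  harmonic n * rlKernel (α * (n + 1)) t + α * rlKernelDeriv (α * (n + 1)) t

theorem pow_div_factorial_mul_log_add (n : ℕ) (x : ℝ) :
    x ^ n / n.factorial * (Real.log x + Real.eulerMascheroniConstant) =
      harmonic n * rlKernel (n + 1) x + rlKernelDeriv (n + 1) x := by
  rw [rlKernelDeriv, rlKernel_nat_add_one, realDigamma_nat_add_one]
  ring

theorem integrableOn_efrosKernel_mul_log_mul_exp (hα : 0 < α) (hα1 : α < 1) (ht : 0 < t)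
    (c μ : ℝ) :
    IntegrableOn (fun x => (Real.log x + c) * efrosKernel α 0 t x * Real.exp (μ * x)) (Ioi 0) := by
  have hint := integrableOn_efrosKernel_mul_exp hα hα1 ht μ
  have hlog := (hasDerivAt_integral_rpow_mul (p := 1) hint.locallyIntegrableOn
    (isBigO_atTop_efrosKernel_mul_exp hα hα1 ht μ 2) one_lt_two
    (isBigO_nhdsGT_zero_efrosKernel_mul_exp hα hα1 ht μ) one_pos).2.1
  simp only [sub_self, Real.rpow_zero, one_mul] at hlog
  refine (hlog.add (hint.const_mul c)).congr_fun (fun x _ => ?_) measurableSet_Ioi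
  simp only [Pi.add_apply]
  ring

theorem integral_pow_div_factorial_mul_log_mul_efrosKernel (hα : 0 < α) (hα1 : α < 1) (ht : 0 < t)
    (n : ℕ) :
    ∫ x in Ioi 0, x ^ n / n.factorial *
      ((Real.log x + Real.eulerMascheroniConstant) * efrosKernel α 0 t x) = efrosTerm α n t := by
  have hn : (0 : ℝ) < n + 1 := n.cast_add_one_pos
  obtain ⟨hint, hint_deriv, hderiv⟩ := integral_rlKernelDeriv_mul_efrosKernel hα hα1 ht hn
  have hsplit (x : ℝ) : x ^ n / n.factorial *
      ((Real.log x + Real.eulerMascheroniConstant) * efrosKernel α 0 t x) =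
        harmonic n * (rlKernel (n + 1) x * efrosKernel α 0 t x) +
          rlKernelDeriv (n + 1) x * efrosKernel α 0 t x := by
    rw [← mul_assoc, pow_div_factorial_mul_log_add]
    ring
  simp only [hsplit]
  rw [integral_add (hint.const_mul _) hint_deriv, integral_const_mul, hderiv,
    integral_rlKernel_mul_efrosKernel hα hα1 ht hn, efrosTerm]

theorem hasSum_efrosTransform (hα : 0 < α) (hα1 : α ≤ 1) (ht : 0 < t) (lam : ℝ) :
    HasSum (fun n : ℕ => lam ^ n * efrosTerm α n t)
      (efrosTransform α
        (fun x => Real.exp (lam * x) * (Real.log x + Real.eulerMascheroniConstant)) t) := by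
  rcases hα1.lt_or_eq with hα1 | rfl
  · have hint := integrableOn_efrosKernel_mul_log_mul_exp hα hα1 ht
      Real.eulerMascheroniConstant |lam|
    replace hint := hint.congr_fun (g := fun x => (Real.log x + Real.eulerMascheroniConstant) *
      efrosKernel α 0 t x * Real.exp |lam * x|) (fun x (hx : 0 < x) => by
        simp only [abs_mul, abs_of_pos hx]) measurableSet_Ioi
    have hsum := hasSum_integral_mul_exp (Measurable.aestronglyMeasurable (by fun_prop)) hint
    simp only [integral_pow_div_factorial_mul_log_mul_efrosKernel hα hα1 ht] at hsum
    simpa only [efrosTransform, if_neg hα1.ne, mul_left_comm, mul_comm] using hsum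
  · rw [efrosTransform, if_pos rfl, Real.exp_eq_exp_ℝ]
    refine ((NormedSpace.expSeries_div_hasSum_exp (lam * t)).mul_right _).congr_fun fun n => ?_
    rw [mul_pow, mul_div_assoc, mul_assoc, pow_div_factorial_mul_log_add, efrosTerm]
    simp only [one_mul]

end EfrosTransform

section RisingBinom

/-- The coefficient `(g)ₖ / k!` of the Prabhakar function. -/
noncomputable def risingBinom (g : ℝ) (k : ℕ) : ℝ := (ascPochhammer ℝ k).eval g / k.factorial

/-- The derivative of `(g)ₖ / k!` with respect to `g`. -/
noncomputable def risingBinomDeriv (g : ℝ) (k : ℕ) : ℝ :=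
  (ascPochhammer ℝ k).derivative.eval g / k.factorial

theorem hasDerivAt_risingBinom (g : ℝ) (k : ℕ) :
    HasDerivAt (fun g => risingBinom g k) (risingBinomDeriv g k) g :=
  ((ascPochhammer ℝ k).hasDerivAt g).div_const _

theorem succ_mul_risingBinom (g : ℝ) (k : ℕ) :
    (k + 1) * risingBinom g (k + 1) = (g + k) * risingBinom g k := by
  have : (k.factorial : ℝ) ≠ 0 := by positivity
  rw [risingBinom, risingBinom, ascPochhammer_succ_eval, Nat.factorial_succ]
  push_cast
  field_simp

theorem succ_mul_risingBinomDeriv (g : ℝ) (k : ℕ) :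
    (k + 1) * risingBinomDeriv g (k + 1) = (g + k) * risingBinomDeriv g k + risingBinom g k := by
  have hleft := (hasDerivAt_risingBinom g (k + 1)).const_mul ((k : ℝ) + 1)
  have hright := ((hasDerivAt_id' g).add_const (k : ℝ)).fun_mul (hasDerivAt_risingBinom g k)
  simp only [succ_mul_risingBinom] at hleft
  rw [hleft.unique hright]
  ring

theorem risingBinom_one (k : ℕ) : risingBinom 1 k = 1 := by
  rw [risingBinom, ascPochhammer_eval_one, div_self (by positivity)]

theorem risingBinomDeriv_one (k : ℕ) : risingBinomDeriv 1 k = harmonic k := by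
  induction k with
  | zero => simp [risingBinomDeriv]
  | succ k ih =>
    have hrec := succ_mul_risingBinomDeriv 1 k
    have hk : (k : ℝ) + 1 ≠ 0 := by positivity
    rw [ih, risingBinom_one] at hrec
    rw [harmonic_succ]
    push_cast
    field_simp
    linarith

theorem risingBinom_eq_neg_one_pow_mul_choose (g : ℝ) (k : ℕ) :
    risingBinom g k = (-1) ^ k * Ring.choose (-g) k := by
  rw [risingBinom, ← neg_neg g, ascPochhammer_eval_neg_eq_descPochhammer,
    descPochhammer_eval_eq_ascPochhammer, neg_neg, Ring.choose_eq_smul,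
    Polynomial.descPochhammer_smeval_eq_ascPochhammer, Polynomial.ascPochhammer_smeval_eq_eval,
    smul_eq_mul]
  ring

theorem sum_risingBinom_mul_risingBinom (g h : ℝ) (N : ℕ) :
    ∑ p ∈ antidiagonal N, risingBinom g p.1 * risingBinom h p.2 =
      risingBinom (g + h) N := by
  simp only [risingBinom_eq_neg_one_pow_mul_choose, neg_add]
  rw [Ring.add_choose_eq N (Commute.all _ _), Finset.mul_sum]
  refine Finset.sum_congr rfl fun p hp => ?_
  rw [← mem_antidiagonal.1 hp, pow_add]
  ring

theorem sum_risingBinom (g : ℝ) (N : ℕ) :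
    ∑ p ∈ antidiagonal N, risingBinom (g - 1) p.1 = risingBinom g N := by
  simpa [risingBinom_one] using sum_risingBinom_mul_risingBinom (g - 1) 1 N

/-- The Chu–Vandermonde identity for `(g - 1) + h`, differentiated in `h` at `h = 1`. -/
theorem sum_risingBinom_mul_harmonic (g : ℝ) (N : ℕ) :
    ∑ p ∈ antidiagonal N, risingBinom (g - 1) p.1 * harmonic p.2 =
      risingBinomDeriv g N := by
  have hsum : HasDerivAt
      (fun h => ∑ p ∈ antidiagonal N, risingBinom (g - 1) p.1 * risingBinom h p.2)
      (∑ p ∈ antidiagonal N, risingBinom (g - 1) p.1 * risingBinomDeriv 1 p.2) 1 :=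
    HasDerivAt.fun_sum fun p _ => (hasDerivAt_risingBinom 1 p.2).const_mul _
  simp only [sum_risingBinom_mul_risingBinom, risingBinomDeriv_one] at hsum
  have htranslate := (hasDerivAt_risingBinom (g - 1 + 1) N).comp_const_add (g - 1) 1
  rw [hsum.unique htranslate, sub_add_cancel]

theorem sum_risingBinom_mul_harmonic_mul_add (g x y : ℝ) (N : ℕ) :
    ∑ p ∈ antidiagonal N, risingBinom (g - 1) p.1 * (harmonic p.2 * x + y) =
      risingBinomDeriv g N * x + risingBinom g N * y := by
  simp only [mul_add, ← mul_assoc]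
  rw [Finset.sum_add_distrib, ← Finset.sum_mul, ← Finset.sum_mul, sum_risingBinom_mul_harmonic,
    sum_risingBinom]

variable {g R : ℝ}

theorem abs_add_natCast_le (hR : 1 ≤ R) (hg : |g| ≤ R) (k : ℕ) : |g + k| ≤ (k + 1) * R := by
  have hk : (k : ℝ) ≤ k * R := le_mul_of_one_le_right k.cast_nonneg hR
  calc |g + k| ≤ |g| + k := by simpa using abs_add_le g k
    _ ≤ (k + 1) * R := by linarith

theorem abs_risingBinom_le (hR : 1 ≤ R) (hg : |g| ≤ R) (k : ℕ) : |risingBinom g k| ≤ R ^ k := by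
  induction k with
  | zero => simp [risingBinom]
  | succ k ih =>
    have hk : (0 : ℝ) < k + 1 := by positivity
    refine le_of_mul_le_mul_left ?_ hk
    calc (k + 1) * |risingBinom g (k + 1)| = |g + k| * |risingBinom g k| := by
          rw [← abs_mul, ← succ_mul_risingBinom, abs_mul, abs_of_pos hk]
      _ ≤ (k + 1) * R * R ^ k := by gcongr; exact abs_add_natCast_le hR hg k
      _ = (k + 1) * R ^ (k + 1) := by ring

theorem abs_risingBinomDeriv_le (hR : 1 ≤ R) (hg : |g| ≤ R) (k : ℕ) :
    |risingBinomDeriv g k| ≤ k * R ^ k := by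
  induction k with
  | zero => simp [risingBinomDeriv]
  | succ k ih =>
    have hk : (0 : ℝ) < k + 1 := by positivity
    refine le_of_mul_le_mul_left ?_ hk
    have hRk : R ^ k ≤ (k + 1) * R * R ^ k :=
      le_mul_of_one_le_left (by positivity) (one_le_mul_of_one_le_of_one_le (by simp) hR)
    calc (k + 1) * |risingBinomDeriv g (k + 1)|
        = |(g + k) * risingBinomDeriv g k + risingBinom g k| := by
          rw [← succ_mul_risingBinomDeriv, abs_mul, abs_of_pos hk]
      _ ≤ |g + k| * |risingBinomDeriv g k| + |risingBinom g k| := by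
          rw [← abs_mul]; exact abs_add_le _ _
      _ ≤ (k + 1) * R * (k * R ^ k) + (k + 1) * R * R ^ k := by
          gcongr
          exacts [abs_add_natCast_le hR hg k, (abs_risingBinom_le hR hg k).trans hRk]
      _ = (k + 1) * ((k + 1 : ℕ) * R ^ (k + 1)) := by push_cast; ring

theorem abs_harmonic_le (n : ℕ) : |(harmonic n : ℝ)| ≤ n := by
  simpa [risingBinomDeriv_one] using abs_risingBinomDeriv_le le_rfl abs_one.le n

theorem abs_risingBinom_le_add_one_mul (hR : 1 ≤ R) (hg : |g| ≤ R) (k : ℕ) :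
    |risingBinom g k| ≤ (k + 1) * R ^ k :=
  (abs_risingBinom_le hR hg k).trans (le_mul_of_one_le_left (by positivity) (by simp))

theorem abs_risingBinomDeriv_le_add_one_mul (hR : 1 ≤ R) (hg : |g| ≤ R) (k : ℕ) :
    |risingBinomDeriv g k| ≤ (k + 1) * R ^ k :=
  (abs_risingBinomDeriv_le hR hg k).trans (by gcongr; linarith)

end RisingBinom

section MittagLeffler

/-- A summable majorant, uniform on `(0, T]` for `x = ρ * T ^ a`, of the coefficients of a
Mittag-Leffler type series with respect to its first term. -/
noncomputable def mlBound (a b x : ℝ) (k : ℕ) : ℝ :=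
  (k + 1) * x ^ k * (Real.Gamma b / Real.Gamma (a * k + b))

variable {a b g lam s t T R x : ℝ}

theorem summable_mlBound (ha : 0 < a) (hb : 0 < b) (hx : 0 ≤ x) : Summable (mlBound a b x) := by
  have := Real.Gamma_pos_of_pos hb
  have hG (k : ℕ) : 0 < Real.Gamma (a * k + b) := Real.Gamma_pos_of_pos (by positivity)
  refine Summable.of_nonneg_of_le (fun k => ?_) (fun k => ?_)
    ((summable_pow_div_Gamma ha hb (x := 2 * x) (by positivity)).mul_left (Real.Gamma b))
  · have := hG k
    unfold mlBound
    positivity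
  · have := hG k
    have hk : (k : ℝ) + 1 ≤ 2 ^ k := mod_cast Nat.lt_two_pow_self (n := k)
    calc mlBound a b x k ≤ 2 ^ k * x ^ k * (Real.Gamma b / Real.Gamma (a * k + b)) := by
          unfold mlBound; gcongr
      _ = Real.Gamma b * ((2 * x) ^ k / Real.Gamma (a * k + b)) := by rw [mul_pow]; ring

theorem mlBound_nonneg (ha : 0 < a) (hb : 0 < b) (hx : 0 ≤ x) (k : ℕ) : 0 ≤ mlBound a b x k := by
  have := Real.Gamma_pos_of_pos hb
  have := Real.Gamma_pos_of_pos (by positivity : 0 < a * k + b)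
  unfold mlBound
  positivity

theorem rlKernel_pos (ha : 0 < a) (ht : 0 < t) : 0 < rlKernel a t :=
  div_pos (Real.rpow_pos_of_pos ht _) (Real.Gamma_pos_of_pos ha)

theorem rlKernel_mul_natCast_add (ht : 0 < t) (a b : ℝ) (k : ℕ) :
    rlKernel (a * k + b) t = t ^ (b - 1) * ((t ^ a) ^ k / Real.Gamma (a * k + b)) := by
  have hpow : t ^ (a * k + b - 1) = (t ^ a) ^ k * t ^ (b - 1) := by
    rw [← Real.rpow_natCast, ← Real.rpow_mul ht.le, ← Real.rpow_add ht]
    ring_nf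
  rw [rlKernel, hpow]
  ring

theorem rlKernel_mul_natCast_add_le (ha : 0 < a) (hb : 0 < b) (hs : 0 < s) (hsT : s ≤ T) (k : ℕ) :
    rlKernel (a * k + b) s ≤
      (T ^ a) ^ k * (Real.Gamma b / Real.Gamma (a * k + b)) * rlKernel b s := by
  have := Real.Gamma_pos_of_pos hb
  have := Real.Gamma_pos_of_pos (by positivity : 0 < a * k + b)
  rw [rlKernel_mul_natCast_add hs]
  calc s ^ (b - 1) * ((s ^ a) ^ k / Real.Gamma (a * k + b))
      ≤ s ^ (b - 1) * ((T ^ a) ^ k / Real.Gamma (a * k + b)) := by gcongr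
    _ = _ := by rw [rlKernel]; field_simp

theorem abs_mul_rlKernel_le (ha : 0 < a) (hb : 0 < b) (hs : 0 < s) (hsT : s ≤ T) (hR : 0 ≤ R)
    {q : ℝ} {k : ℕ} (hq : |q| ≤ (k + 1) * R ^ k) :
    |q * lam ^ k * rlKernel (a * k + b) s| ≤
      mlBound a b (R * |lam| * T ^ a) k * rlKernel b s := by
  have hkernel := rlKernel_mul_natCast_add_le ha hb hs hsT k
  have hpos := rlKernel_pos (by positivity : 0 < a * k + b) hs
  rw [abs_mul, abs_mul, abs_pow, abs_of_pos hpos, mlBound, mul_pow, mul_pow]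
  calc |q| * |lam| ^ k * rlKernel (a * k + b) s
      ≤ (k + 1) * R ^ k * |lam| ^ k *
        ((T ^ a) ^ k * (Real.Gamma b / Real.Gamma (a * k + b)) * rlKernel b s) := by gcongr
    _ = _ := by ring

theorem rpow_mul_prabhakar_term (ht : 0 < t) (k : ℕ) :
    t ^ (b - 1) * ((ascPochhammer ℝ k).eval g * (lam * t ^ a) ^ k /
      ((k.factorial : ℝ) * Real.Gamma (a * k + b))) =
      risingBinom g k * lam ^ k * rlKernel (a * k + b) t := by
  rw [rlKernel_mul_natCast_add ht, risingBinom, mul_pow]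
  ring

theorem hasSum_prabhakar (ha : 0 < a) (hb : 0 < b) (ht : 0 < t) (g lam : ℝ) :
    HasSum (fun k : ℕ => risingBinom g k * lam ^ k * rlKernel (a * k + b) t)
      (t ^ (b - 1) * prabhakar a b g (lam * t ^ a)) := by
  have hbound := (summable_mlBound ha hb
    (by positivity : 0 ≤ (|g| + 1) * |lam| * t ^ a)).mul_right (rlKernel b t)
  have hsum : Summable fun k : ℕ => risingBinom g k * lam ^ k * rlKernel (a * k + b) t :=
    Summable.of_norm_bounded hbound fun k => abs_mul_rlKernel_le ha hb ht le_rfl (by positivity)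
      (abs_risingBinom_le_add_one_mul (by simp) (by simp) k)
  simpa only [prabhakar, ← tsum_mul_left, rpow_mul_prabhakar_term ht] using hsum.hasSum

theorem hasDerivAt_prabhakar (ha : 0 < a) (hb : 0 < b) (ht : 0 < t) (g lam : ℝ) :
    Summable (fun k : ℕ => risingBinomDeriv g k * lam ^ k * rlKernel (a * k + b) t) ∧
      HasDerivAt (fun g => t ^ (b - 1) * prabhakar a b g (lam * t ^ a))
        (∑' k : ℕ, risingBinomDeriv g k * lam ^ k * rlKernel (a * k + b) t) g := by
  set R := |g| + 1
  have hbound := (summable_mlBound ha hb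
    (by positivity : 0 ≤ R * |lam| * t ^ a)).mul_right (rlKernel b t)
  have hle (k : ℕ) (y : ℝ) (hy : y ∈ Metric.ball (0 : ℝ) R) :
      ‖risingBinomDeriv y k * lam ^ k * rlKernel (a * k + b) t‖ ≤
        mlBound a b (R * |lam| * t ^ a) k * rlKernel b t :=
    abs_mul_rlKernel_le ha hb ht le_rfl (by positivity)
      (abs_risingBinomDeriv_le_add_one_mul (by simp [R]) (mem_ball_zero_iff.1 hy).le k)
  have hg : g ∈ Metric.ball (0 : ℝ) R := by simp [R]
  refine ⟨Summable.of_norm_bounded hbound fun k => hle k g hg, ?_⟩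
  have hderiv := hasDerivAt_tsum_of_isPreconnected hbound Metric.isOpen_ball
    (convex_ball (0 : ℝ) R).isPreconnected
    (fun k y _ => ((hasDerivAt_risingBinom y k).mul_const (lam ^ k)).mul_const
      (rlKernel (a * k + b) t)) hle hg (hasSum_prabhakar ha hb ht g lam).summable hg
  simpa only [(hasSum_prabhakar ha hb ht _ lam).tsum_eq] using hderiv

end MittagLeffler

section TermwiseIntegration

variable {X ι κ : Type*} [MeasurableSpace X] {μ : Measure X} [Countable ι] [Countable κ]
  {S : Set X} {f : ι → X → ℝ} {g : κ → X → ℝ} {F G v w : X → ℝ} {B : ι → ℝ} {C : κ → ℝ}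

theorem hasSum_setIntegral_of_le_mul (hS : MeasurableSet S) (hB : Summable B)
    (hw : IntegrableOn w S μ) (hf : ∀ i, AEStronglyMeasurable (f i) (μ.restrict S))
    (hle : ∀ i, ∀ s ∈ S, |f i s| ≤ B i * w s) (hF : ∀ s ∈ S, HasSum (fun i => f i s) (F s)) :
    IntegrableOn F S μ ∧ HasSum (fun i => ∫ s in S, f i s ∂μ) (∫ s in S, F s ∂μ) := by
  have mem := self_mem_ae_restrict (μ := μ) hS
  have hFm : AEStronglyMeasurable F (μ.restrict S) := by
    refine aestronglyMeasurable_of_tendsto_ae (atTop : Filter (Finset ι))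
      (f := fun J s => ∑ i ∈ J, f i s)
      (fun J => Finset.aestronglyMeasurable_fun_sum J fun i _ => hf i) ?_
    filter_upwards [mem] with s hs using hF s hs
  constructor
  · refine (hw.const_mul (∑' i, B i)).mono' hFm ?_
    filter_upwards [mem] with s hs
    rw [← (hF s hs).tsum_eq]
    exact tsum_of_norm_bounded (hB.hasSum.mul_right (w s)) fun i => hle i s hs
  · refine hasSum_integral_of_dominated_convergence (fun i s => B i * w s) hf (fun i => ?_)
      (.of_forall fun s => hB.mul_right _) ?_ ?_
    · filter_upwards [mem] with s hs using hle i s hs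
    · simp only [tsum_mul_right]
      exact hw.const_mul _
    · filter_upwards [mem] with s hs using hF s hs

theorem hasSum_setIntegral_mul_of_le_mul (hS : MeasurableSet S) (hB : Summable B)
    (hC : Summable C) (hB0 : ∀ i, 0 ≤ B i) (hC0 : ∀ j, 0 ≤ C j)
    (hvw : IntegrableOn (fun s => v s * w s) S μ)
    (hf : ∀ i, AEStronglyMeasurable (f i) (μ.restrict S))
    (hg : ∀ j, AEStronglyMeasurable (g j) (μ.restrict S))
    (hfle : ∀ i, ∀ s ∈ S, |f i s| ≤ B i * v s) (hgle : ∀ j, ∀ s ∈ S, |g j s| ≤ C j * w s)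
    (hF : ∀ s ∈ S, HasSum (fun i => f i s) (F s)) (hG : ∀ s ∈ S, HasSum (fun j => g j s) (G s)) :
    IntegrableOn (fun s => F s * G s) S μ ∧
      HasSum (fun p : ι × κ => ∫ s in S, f p.1 s * g p.2 s ∂μ) (∫ s in S, F s * G s ∂μ) := by
  have hBC : Summable fun p : ι × κ => B p.1 * C p.2 := hB.mul_of_nonneg hC hB0 hC0
  have hle (p : ι × κ) (s : X) (hs : s ∈ S) :
      |f p.1 s * g p.2 s| ≤ B p.1 * C p.2 * (v s * w s) := by
    rw [abs_mul, mul_mul_mul_comm]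
    exact mul_le_mul (hfle _ s hs) (hgle _ s hs) (abs_nonneg _)
      ((abs_nonneg _).trans (hfle p.1 s hs))
  exact hasSum_setIntegral_of_le_mul hS hBC hvw (fun p => (hf p.1).mul (hg p.2)) hle fun s hs =>
    (hF s hs).mul (hG s hs) (.of_norm_bounded (hBC.mul_right _) fun p => hle p s hs)

theorem hasSum_sum_antidiagonal {E : Type*} [AddCommMonoid E] [TopologicalSpace E]
    [ContinuousAdd E] [RegularSpace E] {f : ℕ × ℕ → E} {x : E} (hf : HasSum f x) :
    HasSum (fun N => ∑ p ∈ antidiagonal N, f p) x := by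
  rw [← Finset.HasAntidiagonal.sigmaAntidiagonalEquivProd.hasSum_iff] at hf
  exact hf.sigma fun N => (antidiagonal N).hasSum f

end TermwiseIntegration

section PrabhakarConvolution

variable {a b c g lam s t T : ℝ}

theorem rlKernelDeriv_convolution_rlKernel (ha : 0 < a) (hb : 0 < b) (ht : 0 < t) :
    IntegrableOn (fun s => rlKernelDeriv a (t - s) * rlKernel b s) (Ioo 0 t) ∧
      ∫ s in Ioo 0 t, rlKernelDeriv a (t - s) * rlKernel b s = rlKernelDeriv (a + b) t := by
  obtain ⟨-, hint, heq⟩ := rlKernel_convolution hb ha ht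
  rw [← intervalIntegrable_iff_integrableOn_Ioo_of_le ht.le] at hint ⊢
  rw [← integral_Ioc_eq_integral_Ioo, ← intervalIntegral.integral_of_le ht.le] at heq ⊢
  have hint_sub := (hint.comp_sub_left t).symm
  have heq_sub := intervalIntegral.integral_comp_sub_left (a := 0) (b := t)
    (fun s => rlKernel b (t - s) * rlKernelDeriv a s) t
  simp only [sub_zero, sub_self, sub_sub_cancel, mul_comm (rlKernel b _)] at hint_sub heq_sub heq
  exact ⟨hint_sub, by rw [heq_sub, heq, add_comm]⟩

theorem rlKernelDeriv_convolution_prabhakar (ha : 0 < a) (hb : 0 < b) (hc : 0 < c) (ht : 0 < t)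
    (g lam : ℝ) :
    IntegrableOn (fun s => rlKernelDeriv c (t - s) *
        (s ^ (b - 1) * prabhakar a b g (lam * s ^ a))) (Ioo 0 t) ∧
      HasSum (fun k : ℕ => risingBinom g k * lam ^ k * rlKernelDeriv (c + (a * k + b)) t)
        (∫ s in Ioo 0 t, rlKernelDeriv c (t - s) *
          (s ^ (b - 1) * prabhakar a b g (lam * s ^ a))) := by
  have hle (k : ℕ) (s : ℝ) (hs : s ∈ Ioo 0 t) :
      |rlKernelDeriv c (t - s) * (risingBinom g k * lam ^ k * rlKernel (a * k + b) s)| ≤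
        mlBound a b ((|g| + 1) * |lam| * t ^ a) k *
          ‖rlKernelDeriv c (t - s) * rlKernel b s‖ := by
    rw [abs_mul, norm_mul, Real.norm_eq_abs, Real.norm_of_nonneg (rlKernel_pos hb hs.1).le,
      mul_left_comm]
    gcongr
    exact abs_mul_rlKernel_le ha hb hs.1 hs.2.le (by positivity)
      (abs_risingBinom_le_add_one_mul (by simp) (by simp) k)
  obtain ⟨hint, hsum⟩ := hasSum_setIntegral_of_le_mul measurableSet_Ioo
    (summable_mlBound ha hb (by positivity))
    (rlKernelDeriv_convolution_rlKernel hc hb ht).1.norm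
    (fun k => Measurable.aestronglyMeasurable (by fun_prop)) hle
    fun s hs => (hasSum_prabhakar ha hb hs.1 g lam).mul_left _
  refine ⟨hint, hsum.congr_fun fun k => ?_⟩
  have hk : 0 < a * k + b := by positivity
  simp only [mul_left_comm (rlKernelDeriv c _)]
  rw [integral_const_mul, (rlKernelDeriv_convolution_rlKernel hc hk ht).2]

@[fun_prop]
theorem measurable_efrosTerm (a : ℝ) (n : ℕ) : Measurable (efrosTerm a n) := by
  unfold efrosTerm; fun_prop

theorem efrosTerm_eq_rlKernel_mul (a : ℝ) (n : ℕ) (s : ℝ) :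
    efrosTerm a n s = rlKernel (a * n + a) s *
      (harmonic n + a * (Real.log s - realDigamma (a * n + a))) := by
  rw [efrosTerm, rlKernelDeriv, mul_add_one]
  ring

theorem abs_harmonic_add_mul_log_sub_realDigamma_le (ha : 0 < a) (n : ℕ) (s : ℝ) :
    |harmonic n + a * (Real.log s - realDigamma (a * n + a))| ≤
      (1 + a * (1 + a + |realDigamma a|)) * ((n + 1) * (1 + |Real.log s|)) := by
  set D := |realDigamma a|
  set L := |Real.log s|
  have : 0 ≤ D := abs_nonneg _
  have hL : 0 ≤ L := abs_nonneg _
  have hn : (0 : ℝ) ≤ n := n.cast_nonneg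
  have hharmonic : |(harmonic n : ℝ)| ≤ (n + 1) * (1 + L) := by
    nlinarith [abs_harmonic_le n, mul_nonneg hn hL]
  have hlog : |Real.log s - realDigamma (a * n + a)| ≤
      (1 + a + D) * ((n + 1) * (1 + L)) := by
    calc |Real.log s - realDigamma (a * n + a)| ≤ L + |realDigamma (a * n + a)| := abs_sub _ _
      _ ≤ L + (D + (a * n + a)) := by
          gcongr; exact abs_realDigamma_le ha (le_add_of_nonneg_left (by positivity))
      _ = L * 1 + D * 1 + a * (n + 1) * 1 := by ring
      _ ≤ (1 + L) * (n + 1) + D * ((n + 1) * (1 + L)) + a * (n + 1) * (1 + L) := by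
          have h1 : 1 ≤ (n : ℝ) + 1 := by linarith
          gcongr
          · linarith
          · exact one_le_mul_of_one_le_of_one_le h1 (by linarith)
          · linarith
      _ = _ := by ring
  calc _ ≤ |(harmonic n : ℝ)| + |a * (Real.log s - realDigamma (a * n + a))| := abs_add_le _ _
    _ ≤ (n + 1) * (1 + L) + a * ((1 + a + D) * ((n + 1) * (1 + L))) := by
        rw [abs_mul, abs_of_pos ha]; gcongr
    _ = _ := by ring

theorem abs_pow_mul_efrosTerm_le (ha : 0 < a) (hs : 0 < s) (hsT : s ≤ T) (n : ℕ) :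
    |lam ^ n * efrosTerm a n s| ≤
      (1 + a * (1 + a + |realDigamma a|)) * mlBound a a (|lam| * T ^ a) n *
        (rlKernel a s * (1 + |Real.log s|)) := by
  have hkernel := abs_mul_rlKernel_le (lam := lam) ha ha hs hsT zero_le_one (q := n + 1) (k := n)
    (by rw [one_pow, mul_one, abs_of_nonneg (by positivity)])
  rw [one_mul, abs_mul, abs_mul, abs_of_nonneg (by positivity : (0 : ℝ) ≤ n + 1)] at hkernel
  rw [efrosTerm_eq_rlKernel_mul, ← mul_assoc, abs_mul, abs_mul]
  calc _ ≤ |lam ^ n| * |rlKernel (a * n + a) s| *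
        ((1 + a * (1 + a + |realDigamma a|)) * ((n + 1) * (1 + |Real.log s|))) := by
        gcongr; exact abs_harmonic_add_mul_log_sub_realDigamma_le ha n s
    _ = (1 + a * (1 + a + |realDigamma a|)) *
        ((n + 1) * |lam ^ n| * |rlKernel (a * n + a) s|) * (1 + |Real.log s|) := by ring
    _ ≤ (1 + a * (1 + a + |realDigamma a|)) *
        (mlBound a a (|lam| * T ^ a) n * rlKernel a s) * (1 + |Real.log s|) := by gcongr
    _ = _ := by ring

theorem integrableOn_rlKernel_mul_log (ha : 0 < a) (hb : 0 < b) (ht : 0 < t) :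
    IntegrableOn (fun s => rlKernel b (t - s) * (rlKernel a s * (1 + |Real.log s|)))
      (Ioo 0 t) := by
  obtain ⟨hint, hderiv, -⟩ := rlKernel_convolution hb ha ht
  refine IntegrableOn.congr_fun (hint.add (hderiv.add (hint.const_mul (realDigamma a))).norm)
    (fun s hs => ?_) measurableSet_Ioo
  have hpos := mul_pos (rlKernel_pos hb (sub_pos.2 hs.2)) (rlKernel_pos ha hs.1)
  have hlog : rlKernel b (t - s) * rlKernelDeriv a s +
      realDigamma a * (rlKernel b (t - s) * rlKernel a s) =
      rlKernel b (t - s) * rlKernel a s * Real.log s := by rw [rlKernelDeriv]; ring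
  simp only [Pi.add_apply]
  rw [hlog, norm_mul, Real.norm_of_nonneg hpos.le, Real.norm_eq_abs]
  ring

theorem integral_rlKernel_mul_efrosTerm (ha : 0 < a) (hb : 0 < b) (ht : 0 < t) (n : ℕ) :
    ∫ s in Ioo 0 t, rlKernel b (t - s) * efrosTerm a n s =
      harmonic n * rlKernel (b + a * (n + 1)) t + a * rlKernelDeriv (b + a * (n + 1)) t := by
  have hn : 0 < a * ((n : ℝ) + 1) := by positivity
  obtain ⟨hint, hint_deriv, hderiv⟩ := rlKernel_convolution hb hn ht
  have hsplit (s : ℝ) : rlKernel b (t - s) * efrosTerm a n s =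
      harmonic n * (rlKernel b (t - s) * rlKernel (a * (n + 1)) s) +
        a * (rlKernel b (t - s) * rlKernelDeriv (a * (n + 1)) s) := by rw [efrosTerm]; ring
  simp only [hsplit]
  rw [integral_add (hint.const_mul _) (hint_deriv.const_mul _), integral_const_mul,
    integral_const_mul, integral_rlKernel_mul_rlKernel hb hn ht, hderiv]

theorem prabhakar_convolution_efrosTransform (ha : 0 < a) (ha1 : a ≤ 1) (hb : 0 < b) (ht : 0 < t)
    (g lam : ℝ) :
    IntegrableOn (fun s => (t - s) ^ (b - 1) * prabhakar a b g (lam * (t - s) ^ a) *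
      efrosTransform a
        (fun x => Real.exp (lam * x) * (Real.log x + Real.eulerMascheroniConstant)) s) (Ioo 0 t) ∧
    HasSum (fun p : ℕ × ℕ => risingBinom g p.1 * lam ^ (p.1 + p.2) *
        (harmonic p.2 * rlKernel (a * (p.1 + p.2 : ℕ) + (b + a)) t +
          a * rlKernelDeriv (a * (p.1 + p.2 : ℕ) + (b + a)) t))
      (∫ s in Ioo 0 t, (t - s) ^ (b - 1) * prabhakar a b g (lam * (t - s) ^ a) *
      efrosTransform a
        (fun x => Real.exp (lam * x) * (Real.log x + Real.eulerMascheroniConstant)) s) := by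
  obtain ⟨hint, hsum⟩ := hasSum_setIntegral_mul_of_le_mul measurableSet_Ioo
    (summable_mlBound ha hb (by positivity : 0 ≤ (|g| + 1) * |lam| * t ^ a))
    ((summable_mlBound ha ha (by positivity : 0 ≤ |lam| * t ^ a)).mul_left
      (1 + a * (1 + a + |realDigamma a|)))
    (mlBound_nonneg ha hb (by positivity))
    (fun n => mul_nonneg (by positivity) (mlBound_nonneg ha ha (by positivity) n))
    (integrableOn_rlKernel_mul_log ha hb ht)
    (f := fun k s => risingBinom g k * lam ^ k * rlKernel (a * k + b) (t - s))
    (fun k => Measurable.aestronglyMeasurable (by fun_prop))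
    (fun n => Measurable.aestronglyMeasurable (by fun_prop))
    (fun k s hs => abs_mul_rlKernel_le ha hb (sub_pos.2 hs.2) (by linarith [hs.1])
      (by positivity) (abs_risingBinom_le_add_one_mul (by simp) (by simp) k))
    (fun n s hs => abs_pow_mul_efrosTerm_le ha hs.1 hs.2.le n)
    (fun s hs => hasSum_prabhakar ha hb (sub_pos.2 hs.2) g lam)
    (fun s hs => hasSum_efrosTransform ha ha1 hs.1 lam)
  refine ⟨hint, hsum.congr_fun fun p => ?_⟩
  have hp : 0 < a * p.1 + b := by positivity
  have horder : a * p.1 + b + a * (p.2 + 1) = a * (p.1 + p.2 : ℕ) + (b + a) := by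
    push_cast; ring
  simp only [mul_mul_mul_comm _ (rlKernel _ _)]
  rw [integral_const_mul, integral_rlKernel_mul_efrosTerm ha hp ht, horder, pow_add]
  ring

theorem hasSum_prabhakar_convolution_efrosTransform (ha : 0 < a) (ha1 : a ≤ 1) (hb : 0 < b)
    (ht : 0 < t) (g lam : ℝ) :
    HasSum (fun N : ℕ => risingBinomDeriv g N * lam ^ N * rlKernel (a * N + (b + a)) t +
        a * (risingBinom g N * lam ^ N * rlKernelDeriv (a * N + (b + a)) t))
      (∫ s in Ioo 0 t, (t - s) ^ (b - 1) * prabhakar a b (g - 1) (lam * (t - s) ^ a) *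
        efrosTransform a
          (fun x => Real.exp (lam * x) * (Real.log x + Real.eulerMascheroniConstant)) s) := by
  refine (hasSum_sum_antidiagonal
    (prabhakar_convolution_efrosTransform ha ha1 hb ht (g - 1) lam).2).congr_fun fun N => ?_
  rw [mul_assoc, mul_left_comm a, mul_assoc, ← sum_risingBinom_mul_harmonic_mul_add]
  refine Finset.sum_congr rfl fun p hp => ?_
  rw [mem_antidiagonal.1 hp]
  ring

end PrabhakarConvolution

theorem mainTheorem12_general (α β γ lam : ℝ) (hα : 0 < α) (hα1 : α ≤ 1) (hβ : 1 < β) :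
    (α < 1 → ∀ t₁ : ℝ, 0 < t₁ →
      (∀ t₂ : ℝ, 0 < t₂ →
        MeasureTheory.IntegrableOn (efrosKernelIntegrand α 0 t₁ t₂) (Set.Ioi 0)) ∧
      MeasureTheory.IntegrableOn
        (fun t₂ : ℝ => efrosKernel α 0 t₁ t₂ *
          (Real.exp (lam * t₂) * (Real.log t₂ + Real.eulerMascheroniConstant)))
        (Set.Ioi 0)) ∧
    ∀ t : ℝ, 0 ≤ t →
      IntervalIntegrable
        (fun t₁ : ℝ => (Real.log (t - t₁) + Real.eulerMascheroniConstant) *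
          (t₁ ^ (β - 2) * prabhakar α (β - 1) γ (lam * t₁ ^ α)))
        MeasureTheory.volume 0 t ∧
      IntervalIntegrable
        (fun t₁ : ℝ => (t - t₁) ^ (β - α - 1) *
          prabhakar α (β - α) (γ - 1) (lam * (t - t₁) ^ α) *
          efrosTransform α
            (fun t₂ => Real.exp (lam * t₂) * (Real.log t₂ + Real.eulerMascheroniConstant)) t₁)
        MeasureTheory.volume 0 t ∧
      HasDerivAt (fun g : ℝ => t ^ (β - 1) * prabhakar α β g (lam * t ^ α))
        (-(α * ∫ t₁ in (0 : ℝ)..t, (Real.log (t - t₁) + Real.eulerMascheroniConstant) *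
            (t₁ ^ (β - 2) * prabhakar α (β - 1) γ (lam * t₁ ^ α)))
          + ∫ t₁ in (0 : ℝ)..t, (t - t₁) ^ (β - α - 1) *
            prabhakar α (β - α) (γ - 1) (lam * (t - t₁) ^ α) *
            efrosTransform α
              (fun t₂ => Real.exp (lam * t₂) * (Real.log t₂ + Real.eulerMascheroniConstant)) t₁)
        γ := by
  refine ⟨fun h t₁ ht₁ => ⟨fun t₂ _ => integrableOn_efrosKernelIntegrand hα h ht₁ t₂,
    (integrableOn_efrosKernel_mul_log_mul_exp hα h ht₁ _ lam).congr_fun (fun _ _ => by ring)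
      measurableSet_Ioi⟩, fun t ht => ?_⟩
  rcases ht.eq_or_lt with rfl | ht
  · simp [Real.zero_rpow (by linarith : β - 1 ≠ 0), hasDerivAt_const]
  obtain ⟨hlog_int, hlog⟩ :=
    rlKernelDeriv_convolution_prabhakar hα (sub_pos.2 hβ) one_pos ht γ lam
  have hβα : 0 < β - α := by linarith
  have hefros_int := (prabhakar_convolution_efrosTransform hα hα1 hβα ht (γ - 1) lam).1
  have hefros := hasSum_prabhakar_convolution_efrosTransform hα hα1 hβα ht γ lam
  obtain ⟨hsum, hderiv⟩ := hasDerivAt_prabhakar hα (zero_lt_one.trans hβ) ht γ lam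
  simp only [rlKernelDeriv_one, sub_sub, one_add_one_eq_two] at hlog_int hlog
  rw [intervalIntegrable_iff_integrableOn_Ioo_of_le ht.le,
    intervalIntegrable_iff_integrableOn_Ioo_of_le ht.le, intervalIntegral.integral_of_le ht.le,
    intervalIntegral.integral_of_le ht.le, integral_Ioc_eq_integral_Ioo,
    integral_Ioc_eq_integral_Ioo]
  refine ⟨hlog_int, hefros_int, hderiv.congr_deriv (hsum.hasSum.unique ?_)⟩
  refine ((hlog.mul_left α).neg.add hefros).congr_fun fun N => ?_
  rw [sub_add_cancel, show 1 + (α * N + (β - 1)) = α * N + β by ring]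
  ring

end

theorem mainTheorem12 (α β γ lam : ℝ) (hα : 0 < α) (hα1 : α ≤ 1) (hβ : 1 < β) (hγ : 0 < γ) :
    -- for `α < 1` the integrals that define the kernel and its action converge absolutely
    (α < 1 → ∀ t₁ : ℝ, 0 < t₁ →
      (∀ t₂ : ℝ, 0 < t₂ →
        MeasureTheory.IntegrableOn (efrosKernelIntegrand α 0 t₁ t₂) (Set.Ioi 0)) ∧
      MeasureTheory.IntegrableOn
        (fun t₂ : ℝ => efrosKernel α 0 t₁ t₂ *
          (Real.exp (lam * t₂) * (Real.log t₂ + Real.eulerMascheroniConstant)))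
        (Set.Ioi 0)) ∧
    ∀ t : ℝ, 0 ≤ t →
      -- both convolution integrals converge absolutely
      IntervalIntegrable
        (fun t₁ : ℝ => (Real.log (t - t₁) + Real.eulerMascheroniConstant) *
          (t₁ ^ (β - 2) * prabhakar α (β - 1) γ (lam * t₁ ^ α)))
        MeasureTheory.volume 0 t ∧
      IntervalIntegrable
        (fun t₁ : ℝ => (t - t₁) ^ (β - α - 1) *
          prabhakar α (β - α) (γ - 1) (lam * (t - t₁) ^ α) *
          efrosTransform α
            (fun t₂ => Real.exp (lam * t₂) * (Real.log t₂ + Real.eulerMascheroniConstant)) t₁)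
        MeasureTheory.volume 0 t ∧
      -- the derivative with respect to `γ` exists and is given by the formula
      HasDerivAt (fun g : ℝ => t ^ (β - 1) * prabhakar α β g (lam * t ^ α))
        (-(α * ∫ t₁ in (0 : ℝ)..t, (Real.log (t - t₁) + Real.eulerMascheroniConstant) *
            (t₁ ^ (β - 2) * prabhakar α (β - 1) γ (lam * t₁ ^ α)))
          + ∫ t₁ in (0 : ℝ)..t, (t - t₁) ^ (β - α - 1) *
            prabhakar α (β - α) (γ - 1) (lam * (t - t₁) ^ α) *
            efrosTransform α
              (fun t₂ => Real.exp (lam * t₂) * (Real.log t₂ + Real.eulerMascheroniConstant)) t₁)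
        γ :=
  mainTheorem12_general α β γ lam hα hα1 hβ
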